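/- Let $n\ge 1$ and let $M$ be a smooth $n$-dimensional manifold without boundary (Hausdorff, second countable, not necessarily connected). Let $F:M\to\mathbb R^{n+1}$ be a smooth self-expander, that is, a smooth proper immersion whose mean curvature vector satisfies $H=\tfrac12 X^{N}$, where $X=F$ is the position vector and $(\cdot)^N$ is the projection onto the normal space. Suppose that the tangent cone of $M$ at infinity is a hyperplane $P\subset\mathbb R^{n+1}$ through the origin with some integer multiplicity $k\ge1$; that is, as $r\to\infty$ the multiplicity-one $n$-varifolds of the immersions $r^{-1}F$ converge, as Radon measures on $\mathbb R^{n+1}\times G(n,n+1)$, to $k$ times the multiplicity-one varifold of $P$. Then $M$ is the hyperplane $P$: $F(M)=P$, and $F$ maps every connected component of $M$ bijectively onto $P$. -/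

import Mathlib

open Set Filter Topology MeasureTheory
open scoped Manifold ContDiff ENNReal

noncomputable section

namespace SelfExpander

/-- Euclidean space `ℝⁿ`. -/
abbrev Euc (n : ℕ) : Type := EuclideanSpace ℝ (Fin n)

section Immersions

set_option linter.unusedSectionVars false

variable {n m : ℕ} {M : Type*} [TopologicalSpace M] [ChartedSpace (Euc n) M]

/-- The local parametrization `F ∘ e⁻¹` of `F : M → ℝᵐ` given by a chart `e` of `M`
(meaningful on `e.target ⊆ ℝⁿ`). -/
def param (F : M → Euc m) (e : OpenPartialHomeomorph M (Euc n)) : Euc n → Euc m :=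
  fun y => F (e.symm y)

/-- The `i`-th partial derivative of `G` at `y`. -/
def partialDeriv (G : Euc n → Euc m) (i : Fin n) (y : Euc n) : Euc m :=
  fderiv ℝ G y (EuclideanSpace.single i 1)

/-- The second partial derivative `∂ᵢ∂ⱼ G` at `y`. -/
def partialDeriv₂ (G : Euc n → Euc m) (i j : Fin n) (y : Euc n) : Euc m :=
  partialDeriv (partialDeriv G j) i y

/-- The matrix `gᵢⱼ = ⟨∂ᵢ G, ∂ⱼ G⟩` of the metric induced by the parametrization `G`. -/
def metric (G : Euc n → Euc m) (y : Euc n) : Matrix (Fin n) (Fin n) ℝ :=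
  Matrix.of fun i j => inner ℝ (partialDeriv G i y) (partialDeriv G j y)

/-- The tangent plane `dG_y(ℝⁿ)` of a parametrization `G` at `y`. -/
def paramTangent (G : Euc n → Euc m) (y : Euc n) : Submodule ℝ (Euc m) :=
  LinearMap.range (fderiv ℝ G y).toLinearMap

/-- The projection `v ↦ v^N` onto the normal space of the parametrization `G` at `y`. -/
def normalPart (G : Euc n → Euc m) (y : Euc n) (v : Euc m) : Euc m :=
  (paramTangent G y)ᗮ.starProjection v

/-- The mean curvature vector `H = ∑ gⁱʲ (∂ᵢ∂ⱼ G)^N` of the parametrization `G`, that is, the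
trace of the second fundamental form. -/
def meanCurvatureVector (G : Euc n → Euc m) (y : Euc n) : Euc m :=
  ∑ i, ∑ j, (metric G y)⁻¹ i j • normalPart G y (partialDeriv₂ G i j y)

/-- The self-expander equation `H = X^N / 2`, in every chart of `M`. -/
def SatisfiesExpanderEquation (F : M → Euc m) : Prop :=
  ∀ e ∈ atlas (Euc n) M, ∀ y ∈ e.target,
    meanCurvatureVector (param F e) y = (1 / 2 : ℝ) • normalPart (param F e) y (param F e y)

/-- A smooth `n`-dimensional self-expander in `ℝᵐ`: a smooth proper immersion of the
`n`-manifold `M` (without boundary) into `ℝᵐ` with `H = X^N / 2`. -/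
structure IsSmoothSelfExpander (F : M → Euc m) : Prop where
  contMDiff : ContMDiff (𝓡 n) (𝓡 m) ∞ F
  immersion : ∀ p : M, Function.Injective (mfderiv (𝓡 n) (𝓡 m) F p)
  isProperMap : IsProperMap F
  expander : SatisfiesExpanderEquation (n := n) F

/-- The tangent plane `dF_p(T_pM)`, as a linear subspace of `ℝᵐ`. -/
def tangentPlane (F : M → Euc m) (p : M) : Submodule ℝ (Euc m) :=
  LinearMap.range (mfderiv (𝓡 n) (𝓡 m) F p).toLinearMap

/-- The area measure in one chart: `√(det g) dy` on `e.target`, transported to `e.source`. -/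
def chartArea [MeasurableSpace M] (F : M → Euc m) (e : OpenPartialHomeomorph M (Euc n)) :
    Measure M :=
  Measure.map e.symm ((volume.restrict e.target).withDensity
    fun y => ENNReal.ofReal (Real.sqrt (metric (param F e) y).det))

/-- The `n`-dimensional area measure on `M` induced by the immersion `F`. The chart measures
agree on overlaps, so their supremum is the measure on `M` which is `√(det g) dy` in every chart;
see `areaMeasure_restrict`. -/
def areaMeasure [MeasurableSpace M] (F : M → Euc m) : Measure M :=
  ⨆ e : atlas (Euc n) M, chartArea F e.1

theorem chartArea_apply [MeasurableSpace M] [BorelSpace M] (F : M → Euc m)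
    (e : OpenPartialHomeomorph M (Euc n)) {A : Set M} (hA : MeasurableSet A) :
    chartArea F e A = ∫⁻ y in e.symm ⁻¹' A ∩ e.target,
      ENNReal.ofReal (Real.sqrt (metric (param F e) y).det) := by
  have hm : AEMeasurable e.symm (volume.restrict e.target) :=
    e.continuousOn_symm.aemeasurable e.open_target.measurableSet
  rw [chartArea, Measure.map_apply_of_aemeasurable
    (hm.mono_ac (withDensity_absolutelyContinuous _ _)) hA, withDensity_apply',
    Measure.restrict_restrict' e.open_target.measurableSet]

/-- The metric matrix transforms by the Jacobian matrix under a change of parameters. -/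
theorem sqrt_det_metric_comp (G : Euc n → Euc m) (T : Euc n → Euc n) (y : Euc n)
    (hT : DifferentiableAt ℝ T y) (hG : DifferentiableAt ℝ G (T y)) :
    Real.sqrt (metric (G ∘ T) y).det =
      |(fderiv ℝ T y).det| * Real.sqrt (metric G (T y)).det := by
  let b := (EuclideanSpace.basisFun (Fin n) ℝ).toBasis
  let D : Matrix (Fin n) (Fin n) ℝ := LinearMap.toMatrix b b (fderiv ℝ T y).toLinearMap
  have hpd : ∀ i, partialDeriv (G ∘ T) i y = ∑ k, D k i • partialDeriv G k (T y) := by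
    intro i
    have h1 : fderiv ℝ T y (EuclideanSpace.single i 1)
        = ∑ k, D k i • (EuclideanSpace.single k (1 : ℝ)) := by
      have := (b.sum_repr (fderiv ℝ T y (EuclideanSpace.single i 1))).symm
      simpa [D, b, LinearMap.toMatrix_apply] using this
    simp only [partialDeriv]
    rw [fderiv_comp _ hG hT, ContinuousLinearMap.comp_apply, h1]
    simp [map_sum]
  have hmat : metric (G ∘ T) y = D.transpose * metric G (T y) * D := by
    ext i j
    simp only [metric, Matrix.of_apply, hpd, Matrix.mul_apply, Matrix.transpose_apply,
      sum_inner, inner_sum, real_inner_smul_left, real_inner_smul_right, Finset.sum_mul]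
    refine Finset.sum_congr rfl fun a _ => Finset.sum_congr rfl fun c _ => by ring
  have hdet : D.det = (fderiv ℝ T y).det := by
    simp [D, ContinuousLinearMap.det]
  rw [hmat, Matrix.det_mul, Matrix.det_mul, Matrix.det_transpose, hdet,
    show (fderiv ℝ T y).det * (metric G (T y)).det * (fderiv ℝ T y).det
      = (fderiv ℝ T y).det ^ 2 * (metric G (T y)).det by ring,
    Real.sqrt_mul (sq_nonneg _), Real.sqrt_sq_eq_abs]

theorem chartArea_overlap [IsManifold (𝓡 n) ∞ M] [MeasurableSpace M] [BorelSpace M]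
    {F : M → Euc m} (hF : ContMDiff (𝓡 n) (𝓡 m) ∞ F)
    {e e' : OpenPartialHomeomorph M (Euc n)} (he : e ∈ atlas (Euc n) M)
    (he' : e' ∈ atlas (Euc n) M) {A : Set M} (hA : MeasurableSet A)
    (hAe : A ⊆ e.source) (hAe' : A ⊆ e'.source) : chartArea F e A = chartArea F e' A := by
  have hmem : ∀ e ∈ atlas (Euc n) M, e ∈ IsManifold.maximalAtlas (𝓡 n) ∞ M :=
    fun e he => IsManifold.subset_maximalAtlas he
  have hG : ∀ z ∈ e'.target, DifferentiableAt ℝ (param F e') z := by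
    intro z hz
    have h := (hF.comp_contMDiffOn (contMDiffOn_symm_of_mem_maximalAtlas (hmem e' he'))).contDiffOn
    exact (h.contDiffAt (e'.open_target.mem_nhds hz)).differentiableAt (by simp)
  have hT : ∀ y ∈ e.target, e.symm y ∈ e'.source → DifferentiableAt ℝ (e' ∘ e.symm) y := by
    intro y hy hy'
    have h := ((contMDiffOn_of_mem_maximalAtlas (hmem e' he')).comp'
      (contMDiffOn_symm_of_mem_maximalAtlas (hmem e he))).contDiffOn
    refine (h.contDiffAt ?_).differentiableAt (by simp)
    exact (e.isOpen_inter_preimage_symm e'.open_source).mem_nhds ⟨hy, hy'⟩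
  set S := e.symm ⁻¹' A ∩ e.target with hS
  have hSm : MeasurableSet S := by
    have h : Measurable fun y : e.target => e.symm y :=
      (continuousOn_iff_continuous_domRestrict.1 e.continuousOn_symm).measurable
    have h2 := e.open_target.measurableSet.subtype_image (h hA)
    convert h2 using 1
    ext y
    simp [hS, and_comm]
  have himg : (e' ∘ e.symm) '' S = e'.symm ⁻¹' A ∩ e'.target := by
    ext z
    constructor
    · rintro ⟨y, ⟨hyA, hy⟩, rfl⟩
      have h2 := hAe' hyA
      exact ⟨by simpa [e'.left_inv h2] using hyA, e'.map_source h2⟩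
    · rintro ⟨hzA, hz⟩
      have h2 := hAe hzA
      refine ⟨e (e'.symm z), ⟨?_, e.map_source h2⟩, ?_⟩
      · simpa [e.left_inv h2] using hzA
      · simp [e.left_inv h2, e'.right_inv hz]
  have hinj : InjOn (e' ∘ e.symm) S := by
    rintro y ⟨hyA, hy⟩ z ⟨hzA, hz⟩ h
    exact e.symm.injOn hy hz (e'.injOn (hAe' hyA) (hAe' hzA) h)
  rw [chartArea_apply F e hA, chartArea_apply F e' hA, ← himg,
    lintegral_image_eq_lintegral_abs_det_fderiv_mul volume hSm
      (fun y hy => (hT y hy.2 (hAe' hy.1)).hasFDerivAt.hasFDerivWithinAt) hinj]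
  refine setLIntegral_congr_fun hSm fun y hy => ?_
  have hloc : param F e =ᶠ[𝓝 y] param F e' ∘ (e' ∘ e.symm) := by
    filter_upwards [(e.isOpen_inter_preimage_symm e'.open_source).mem_nhds
      ⟨hy.2, hAe' hy.1⟩] with z hz
    simp only [param, Function.comp_apply]
    rw [e'.left_inv hz.2]
  have hmet : metric (param F e) y = metric (param F e' ∘ (e' ∘ e.symm)) y := by
    simp only [metric, partialDeriv, hloc.fderiv_eq]
  rw [hmet, sqrt_det_metric_comp _ _ _ (hT y hy.2 (hAe' hy.1))
    (hG _ (e'.map_source (hAe' hy.1))), ENNReal.ofReal_mul (abs_nonneg _)]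

theorem chartArea_compl_source [MeasurableSpace M] [BorelSpace M] (F : M → Euc m)
    (e : OpenPartialHomeomorph M (Euc n)) : chartArea F e e.sourceᶜ = 0 := by
  have h : e.symm ⁻¹' e.sourceᶜ ∩ e.target = ∅ := by
    ext y
    simp only [mem_inter_iff, mem_preimage, mem_compl_iff, mem_empty_iff_false, iff_false, not_and]
    exact fun h hy => h (e.map_target hy)
  rw [chartArea_apply F e e.open_source.measurableSet.compl, h]
  simp

/-- In every chart the area measure is `√(det g) dy`. -/
theorem areaMeasure_restrict [IsManifold (𝓡 n) ∞ M] [SecondCountableTopology M]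
    [MeasurableSpace M] [BorelSpace M] {F : M → Euc m} (hF : ContMDiff (𝓡 n) (𝓡 m) ∞ F)
    {e : OpenPartialHomeomorph M (Euc n)} (he : e ∈ atlas (Euc n) M) :
    (areaMeasure (n := n) F).restrict e.source = chartArea F e := by
  have hle : chartArea F e ≤ areaMeasure (n := n) F :=
    le_iSup (fun e : atlas (Euc n) M => chartArea F e.1) ⟨e, he⟩
  -- a countable cover by charts, made disjoint
  obtain ⟨s, hsc, hs⟩ := TopologicalSpace.countable_cover_nhds
    (fun p : M => (chartAt (Euc n) p).open_source.mem_nhds (mem_chart_source (Euc n) p))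
  have : Countable s := hsc.to_subtype
  obtain ⟨D, hDm, hDsub, hDd, hDU⟩ : ∃ D : s → Set M, (∀ i, MeasurableSet (D i)) ∧
      (∀ i, D i ⊆ (chartAt (Euc n) i.1).source) ∧ Pairwise (Function.onFun Disjoint D) ∧
      ⋃ i, D i = univ := by
    obtain ⟨f, hf⟩ := exists_injective_nat s
    refine ⟨fun i => (chartAt (Euc n) i.1).source \ ⋃ j : {j : s // f j < f i},
      (chartAt (Euc n) j.1.1).source, fun i => ?_, fun i => sdiff_subset, ?_, ?_⟩
    · exact (chartAt (Euc n) i.1).open_source.measurableSet.diff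
        (MeasurableSet.iUnion fun j => (chartAt (Euc n) j.1.1).open_source.measurableSet)
    · intro i j hij
      rw [Function.onFun, Set.disjoint_left]
      rintro x ⟨hi, hi'⟩ ⟨hj, hj'⟩
      rcases lt_trichotomy (f i) (f j) with h | h | h
      · exact hj' (mem_iUnion.2 ⟨⟨i, h⟩, hi⟩)
      · exact hij (hf h)
      · exact hi' (mem_iUnion.2 ⟨⟨j, h⟩, hj⟩)
    · refine eq_univ_of_forall fun x => ?_
      have hx : ∃ k, ∃ i : s, f i = k ∧ x ∈ (chartAt (Euc n) i.1).source := by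
        have : x ∈ ⋃ i ∈ s, (chartAt (Euc n) i).source := hs ▸ mem_univ x
        simp only [mem_iUnion] at this
        obtain ⟨i, hi, hx⟩ := this
        exact ⟨_, ⟨i, hi⟩, rfl, hx⟩
      classical
      obtain ⟨i, hi, hxi⟩ := Nat.find_spec hx
      refine mem_iUnion.2 ⟨i, hxi, fun hxj => ?_⟩
      obtain ⟨⟨j, hj⟩, hxj⟩ := mem_iUnion.1 hxj
      exact Nat.find_min hx (hi ▸ hj) ⟨j, rfl, hxj⟩
  -- the glued measure
  let ν : Measure M := Measure.sum fun i : s => (chartArea F (chartAt (Euc n) i.1)).restrict (D i)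
  have hνe : ∀ e' ∈ atlas (Euc n) M, ∀ A, MeasurableSet A → A ⊆ e'.source →
      ν A = chartArea F e' A := by
    intro e' he' A hA hAs
    have h1 : ∀ i, ((chartArea F (chartAt (Euc n) i.1)).restrict (D i)) A
        = chartArea F e' (A ∩ D i) := by
      intro i
      rw [Measure.restrict_apply hA]
      exact chartArea_overlap hF (chart_mem_atlas _ _) he' (hA.inter (hDm i))
        (inter_subset_right.trans (hDsub i)) (inter_subset_left.trans hAs)
    rw [Measure.sum_apply _ hA, tsum_congr h1, ← measure_iUnion
      (fun i j hij => (hDd hij).mono inter_subset_right inter_subset_right)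
      (fun i => hA.inter (hDm i)), ← inter_iUnion, hDU, inter_univ]
  have hsrc : ∀ e' : OpenPartialHomeomorph M (Euc n), ∀ A,
      chartArea F e' (A ∩ e'.source) = chartArea F e' A := fun e' A =>
    measure_inter_conull (chartArea_compl_source F e')
  have hν : areaMeasure (n := n) F ≤ ν := by
    refine iSup_le ?_
    rintro ⟨e', he'⟩
    refine Measure.le_iff.2 fun A hA => ?_
    rw [← hsrc, ← hνe e' he' _ (hA.inter e'.open_source.measurableSet) inter_subset_right]
    exact measure_mono inter_subset_left
  refine le_antisymm ?_ ?_ <;> refine Measure.le_iff.2 fun A hA => ?_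
  · rw [Measure.restrict_apply hA, ← hsrc,
      ← hνe e he _ (hA.inter e.open_source.measurableSet) inter_subset_right]
    exact hν _
  · rw [Measure.restrict_apply hA, ← hsrc]
    exact hle _

/-- The value on a test function `φ` of the (multiplicity one) varifold of the immersion `F`.
An `n`-plane of `ℝᵐ` is represented by the orthogonal projection onto it. -/
def varifold [MeasurableSpace M] (F : M → Euc m) (φ : Euc m × (Euc m →L[ℝ] Euc m) → ℝ) : ℝ :=
  ∫ p, φ (F p, (tangentPlane (n := n) F p).starProjection) ∂(areaMeasure (n := n) F)

/-- The value on a test function `φ` of the multiplicity one varifold of a linear subspace `P`. -/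
def planeVarifold (P : Submodule ℝ (Euc m)) (φ : Euc m × (Euc m →L[ℝ] Euc m) → ℝ) : ℝ :=
  ∫ x : P, φ ((x : Euc m), P.starProjection)

/-- The tangent cone at infinity of the immersed `F : M → ℝᵐ` is `P` with multiplicity `k`:
the varifolds of `r⁻¹ F` converge to `k` times the varifold of `P` as `r → ∞`. Every compactly
supported continuous function on `ℝᵐ × G(n, m)` is the restriction of a `φ` as below. -/
def HasTangentConeAtInfinity [MeasurableSpace M] (F : M → Euc m) (P : Submodule ℝ (Euc m))
    (k : ℕ) : Prop :=
  ∀ φ : Euc m × (Euc m →L[ℝ] Euc m) → ℝ, Continuous φ → HasCompactSupport φ →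
    Tendsto (fun r : ℝ => varifold (n := n) (fun p => r⁻¹ • F p) φ) atTop
      (𝓝 ((k : ℝ) * planeVarifold P φ))

end Immersions

end SelfExpander

end

/-!
A self-expander `F : M → ℝᵐ` asymptotic to a plane `P` with multiplicity lies in `P`, because its
height over `P` satisfies an integral Phragmén–Lindelöf principle at the critical growth rate.

Fix `e ⊥ P` and write `x = F`, `u = ⟨x, e⟩`, `s = |x|²`. The first variation formula
`∫ (div_M V + ⟨H, V⟩) = 0` (`firstVariation`) is applied to the ambient field
`V = u ζ e + ¼ u² ζ x` with `ζ = g(s)²`. As `H = ½ x^N`, absorbing the mixed gradient term by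
Cauchy–Schwarz gives, for `g g' ≤ 0`, the height inequality
`∫ u² (b g² - 4 s g'² + s g g') ≤ 0` with `b = (n + 2) / 4` (`integral_nonpos_of_le_height`).
The function `s^{-b}` makes the bracket vanish to leading order, and `g = (s + 16 b)^{-b}` makes it
strictly positive. Cutting `g` off at `|x| ~ R` costs an error bounded by `R^{-n-2} ∫ u²` over
`R² ≤ s ≤ 2 R²` (`le_weight_expression`); this is the varifold of `R⁻¹ F` evaluated on a multiple
of `⟨x, e⟩²`, so it tends to `k` times an integral over `P` of a function vanishing on `P`. Hence
`u = 0` (`inner_eq_zero_of_mem_orthogonal`). No monotonicity formula or density bound is needed, and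
the multiplicity `k` plays no role at this point.

Once `F(M) ⊆ P`, the map `F : M → P` is a proper local homeomorphism, hence a covering of a simply
connected space, and it is bijective on every component
(`bijOn_connectedComponent_of_forall_mem`). Finally `M` is nonempty since `k ≥ 1`, whence
`F(M) = P`.

The first variation formula itself is the coordinate identity
`∑ ∂ᵢ (√(det g) gⁱʲ ∂ⱼ G) = √(det g) H` (`sum_fderiv_gradDensity`), integrated by parts in charts
and glued by a partition of unity.
-/

namespace SelfExpander

/-! ### The metric of a parametrization -/

/-- Jacobi's formula: `d(det A) = det A · tr (A⁻¹ dA)`. -/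
theorem hasFDerivAt_det {E ι : Type*} [NormedAddCommGroup E] [NormedSpace ℝ E] [Fintype ι]
    [DecidableEq ι] {A : E → Matrix ι ι ℝ} {A' : ι → ι → E →L[ℝ] ℝ} {y : E}
    (hA : ∀ i j, HasFDerivAt (fun z => A z i j) (A' i j) y) (hdet : (A y).det ≠ 0) :
    HasFDerivAt (fun z => (A z).det) ((A y).det • ∑ i, ∑ j, (A y)⁻¹ i j • A' j i) y := by
  have h : HasFDerivAt (fun z => (A z).det)
      (∑ σ : Equiv.Perm ι, ((Equiv.Perm.sign σ : ℤ) : ℝ) •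
        ∑ i, (∏ j ∈ Finset.univ.erase i, A y (σ j) j) • A' (σ i) i) y := by
    simp only [Matrix.det_apply']
    exact HasFDerivAt.fun_sum fun σ _ =>
      (HasFDerivAt.finsetProd fun i _ => hA (σ i) i).const_mul _
  convert! h using 1
  ext v
  have hinv : ∀ i j, (A y).det * (A y)⁻¹ i j = (A y).adjugate i j := by
    intro i j
    rw [Matrix.inv_def, Ring.inverse_eq_inv', Matrix.smul_apply, smul_eq_mul,
      mul_inv_cancel_left₀ hdet]
  have hcr : ∀ i, ∑ j, (A y).adjugate i j * A' j i v
      = ∑ σ : Equiv.Perm ι, ((Equiv.Perm.sign σ : ℤ) : ℝ) *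
        ((∏ j ∈ Finset.univ.erase i, A y (σ j) j) * A' (σ i) i v) := by
    intro i
    have h1 := congrFun (Matrix.cramer_eq_adjugate_mulVec (A y) fun j => A' j i v) i
    rw [Matrix.cramer_apply, Matrix.det_apply'] at h1
    rw [show ∑ j, (A y).adjugate i j * A' j i v
      = ((A y).adjugate.mulVec fun j => A' j i v) i from rfl, ← h1]
    refine Finset.sum_congr rfl fun σ _ => ?_
    rw [← Finset.prod_erase_mul _ _ (Finset.mem_univ i)]
    congr 2
    · refine Finset.prod_congr rfl fun j hj => ?_
      rw [Matrix.updateCol_ne (Finset.ne_of_mem_erase hj)]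
    · rw [Matrix.updateCol_self]
  simp only [_root_.smul_apply, _root_.sum_apply, smul_eq_mul,
    Finset.mul_sum, ← mul_assoc, hinv]
  simp only [mul_assoc, hcr]
  rw [Finset.sum_comm]

variable {n m : ℕ}

theorem metric_apply (G : Euc n → Euc m) (y : Euc n) (i j : Fin n) :
    metric G y i j = inner ℝ (partialDeriv G i y) (partialDeriv G j y) := rfl

theorem metric_symm (G : Euc n → Euc m) (y : Euc n) (i j : Fin n) :
    metric G y i j = metric G y j i := by
  rw [metric_apply, metric_apply, real_inner_comm]

theorem metric_isSymm (G : Euc n → Euc m) (y : Euc n) : (metric G y).transpose = metric G y := by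
  ext i j
  exact metric_symm G y j i

theorem metric_inv_symm (G : Euc n → Euc m) (y : Euc n) (i j : Fin n) :
    (metric G y)⁻¹ i j = (metric G y)⁻¹ j i := by
  conv_lhs => rw [← metric_isSymm G y, ← Matrix.transpose_nonsing_inv]
  rfl

/-- A vector of `ℝⁿ` in terms of its coordinates. -/
theorem eq_sum_single (v : Euc n) : v = ∑ i, v i • EuclideanSpace.single i (1 : ℝ) := by
  ext j
  simp [Finset.sum_apply, Pi.single_apply]

theorem fderiv_apply_eq_sum (G : Euc n → Euc m) (y v : Euc n) :
    fderiv ℝ G y v = ∑ i, v i • partialDeriv G i y := by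
  conv_lhs => rw [eq_sum_single v]
  simp [partialDeriv]

theorem linearIndependent_partialDeriv {G : Euc n → Euc m} {y : Euc n}
    (hG : Function.Injective (fderiv ℝ G y)) :
    LinearIndependent ℝ fun i => partialDeriv G i y := by
  have h := (EuclideanSpace.basisFun (Fin n) ℝ).toBasis.linearIndependent.map'
    (fderiv ℝ G y).toLinearMap (LinearMap.ker_eq_bot.2 hG)
  have he : (fun i => partialDeriv G i y) = (fderiv ℝ G y).toLinearMap ∘
      (EuclideanSpace.basisFun (Fin n) ℝ).toBasis := by
    ext1 i
    simp [partialDeriv]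
  rw [he]
  exact h

theorem det_metric_pos {G : Euc n → Euc m} {y : Euc n}
    (hG : Function.Injective (fderiv ℝ G y)) : 0 < (metric G y).det :=
  (Matrix.posDef_gram_of_linearIndependent (linearIndependent_partialDeriv hG)).det_pos

theorem partialDeriv_mem_paramTangent (G : Euc n → Euc m) (y : Euc n) (i : Fin n) :
    partialDeriv G i y ∈ paramTangent G y := ⟨_, rfl⟩

theorem mem_paramTangent_orthogonal {G : Euc n → Euc m} {y : Euc n} {v : Euc m} :
    v ∈ (paramTangent G y)ᗮ ↔ ∀ i, inner ℝ v (partialDeriv G i y) = 0 := by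
  rw [Submodule.mem_orthogonal']
  refine ⟨fun h i => h _ (partialDeriv_mem_paramTangent G y i), ?_⟩
  rintro h _ ⟨w, rfl⟩
  change inner ℝ v (fderiv ℝ G y w) = 0
  rw [fderiv_apply_eq_sum, inner_sum]
  simp [real_inner_smul_right, h]

theorem sum_inv_metric_mul {G : Euc n → Euc m} {y : Euc n}
    (hG : Function.Injective (fderiv ℝ G y)) (i k : Fin n) :
    ∑ j, (metric G y)⁻¹ i j * metric G y j k = if i = k then 1 else 0 := by
  rw [← Matrix.mul_apply, Matrix.nonsing_inv_mul _ (det_metric_pos hG).ne'.isUnit,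
    Matrix.one_apply]

/-- The tangential projection in coordinates: `v^T = ∑ gⁱʲ ⟨v, ∂ⱼ G⟩ ∂ᵢ G`. -/
theorem starProjection_paramTangent {G : Euc n → Euc m} {y : Euc n}
    (hG : Function.Injective (fderiv ℝ G y)) (v : Euc m) :
    (paramTangent G y).starProjection v
      = ∑ i, ∑ j, ((metric G y)⁻¹ i j * inner ℝ v (partialDeriv G j y)) • partialDeriv G i y := by
  refine Submodule.eq_starProjection_of_mem_orthogonal ?_ ?_
  · exact Submodule.sum_mem _ fun i _ => Submodule.sum_mem _ fun j _ =>
      Submodule.smul_mem _ _ (partialDeriv_mem_paramTangent G y i)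
  · rw [mem_paramTangent_orthogonal]
    intro k
    rw [inner_sub_left, sum_inner]
    simp only [sum_inner, real_inner_smul_left, ← metric_apply]
    rw [Finset.sum_comm]
    have : ∀ j, ∑ i, (metric G y)⁻¹ i j * inner ℝ v (partialDeriv G j y) * metric G y i k
        = inner ℝ v (partialDeriv G j y) * if j = k then 1 else 0 := by
      intro j
      rw [← sum_inv_metric_mul hG, Finset.mul_sum]
      refine Finset.sum_congr rfl fun i _ => ?_
      rw [metric_inv_symm G y j i]
      ring
    simp [this]

/-- The trace of a linear map over the tangent plane, in coordinates. -/
theorem trace_comp_starProjection_paramTangent {G : Euc n → Euc m} {y : Euc n}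
    (hG : Function.Injective (fderiv ℝ G y)) (L : Euc m →L[ℝ] Euc m) :
    ∑ i, ∑ j, (metric G y)⁻¹ i j * inner ℝ (L (partialDeriv G i y)) (partialDeriv G j y)
      = LinearMap.trace ℝ (Euc m) (L ∘L (paramTangent G y).starProjection).toLinearMap := by
  have h : (L ∘L (paramTangent G y).starProjection).toLinearMap
      = ∑ i, ∑ j, (metric G y)⁻¹ i j •
        (innerₛₗ ℝ (partialDeriv G j y)).smulRight (L (partialDeriv G i y)) := by
    ext1 v
    simp [starProjection_paramTangent hG, map_sum, mul_smul, LinearMap.sum_apply, real_inner_comm]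
  rw [h]
  simp only [map_sum, map_smul, LinearMap.trace_smulRight, innerₛₗ_apply_apply, smul_eq_mul,
    real_inner_comm]

/-! ### The coordinate form of the first variation formula -/

theorem contDiffAt_det {E ι : Type*} [NormedAddCommGroup E] [NormedSpace ℝ E] [Fintype ι]
    [DecidableEq ι] {k : ℕ∞ω} {A : E → Matrix ι ι ℝ} {y : E}
    (hA : ∀ i j, ContDiffAt ℝ k (fun z => A z i j) y) :
    ContDiffAt ℝ k (fun z => (A z).det) y := by
  simp only [Matrix.det_apply']
  exact ContDiffAt.sum fun σ _ => contDiffAt_const.mul (contDiffAt_prod fun i _ => hA _ _)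

theorem contDiffAt_inv_apply {E ι : Type*} [NormedAddCommGroup E] [NormedSpace ℝ E] [Fintype ι]
    [DecidableEq ι] {k : ℕ∞ω} {A : E → Matrix ι ι ℝ} {y : E}
    (hA : ∀ i j, ContDiffAt ℝ k (fun z => A z i j) y) (hdet : (A y).det ≠ 0) (i j : ι) :
    ContDiffAt ℝ k (fun z => (A z)⁻¹ i j) y := by
  simp only [Matrix.inv_def, Ring.inverse_eq_inv', Matrix.smul_apply, smul_eq_mul,
    Matrix.adjugate_apply]
  refine ((contDiffAt_det hA).inv hdet).mul (contDiffAt_det fun a b => ?_)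
  by_cases h : a = j
  · subst h
    simpa only [Matrix.updateRow_self] using contDiffAt_const
  · simpa only [Matrix.updateRow_ne h] using hA a b

theorem contDiffAt_partialDeriv {G : Euc n → Euc m} {y : Euc n} (hG : ContDiffAt ℝ ∞ G y)
    (i : Fin n) : ContDiffAt ℝ ∞ (partialDeriv G i) y :=
  (hG.fderiv_right (by simp)).clm_apply contDiffAt_const

theorem contDiffAt_metric {G : Euc n → Euc m} {y : Euc n} (hG : ContDiffAt ℝ ∞ G y)
    (i j : Fin n) : ContDiffAt ℝ ∞ (fun z => metric G z i j) y :=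
  (contDiffAt_partialDeriv hG i).inner ℝ (contDiffAt_partialDeriv hG j)

theorem contDiffAt_inv_metric {G : Euc n → Euc m} {y : Euc n} (hG : ContDiffAt ℝ ∞ G y)
    (hi : Function.Injective (fderiv ℝ G y)) (i j : Fin n) :
    ContDiffAt ℝ ∞ (fun z => (metric G z)⁻¹ i j) y :=
  contDiffAt_inv_apply (contDiffAt_metric hG) (det_metric_pos hi).ne' i j

/-- The area density `√(det g)` of a parametrization. -/
noncomputable def areaDensity (G : Euc n → Euc m) (y : Euc n) : ℝ := Real.sqrt (metric G y).det

theorem areaDensity_pos {G : Euc n → Euc m} {y : Euc n}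
    (hi : Function.Injective (fderiv ℝ G y)) : 0 < areaDensity G y :=
  Real.sqrt_pos.2 (det_metric_pos hi)

theorem contDiffAt_areaDensity {G : Euc n → Euc m} {y : Euc n} (hG : ContDiffAt ℝ ∞ G y)
    (hi : Function.Injective (fderiv ℝ G y)) : ContDiffAt ℝ ∞ (areaDensity G) y :=
  (contDiffAt_det (contDiffAt_metric hG)).sqrt (det_metric_pos hi).ne'

theorem partialDeriv₂_symm {G : Euc n → Euc m} {y : Euc n} (hG : ContDiffAt ℝ ∞ G y)
    (i j : Fin n) : partialDeriv₂ G i j y = partialDeriv₂ G j i y := by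
  have hd : DifferentiableAt ℝ (fderiv ℝ G) y :=
    (hG.fderiv_right (m := ∞) (by simp)).differentiableAt (by simp)
  have h : ∀ a b, partialDeriv₂ G a b y
      = fderiv ℝ (fderiv ℝ G) y (EuclideanSpace.single a 1) (EuclideanSpace.single b 1) := by
    intro a b
    have hb : partialDeriv G b = fun z => fderiv ℝ G z (EuclideanSpace.single b 1) := rfl
    rw [partialDeriv₂, partialDeriv, hb, fderiv_clm_apply hd (differentiableAt_const _)]
    simp
  rw [h, h]
  exact hG.isSymmSndFDerivAt (by simpa using WithTop.coe_le_coe.2 (le_top : (2 : ℕ∞) ≤ ⊤)) _ _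

/-- `∂ₖ √(det g) = √(det g) ∑ gⁱʲ ⟨∂ⱼ G, ∂ᵢ ∂ₖ G⟩`. -/
theorem fderiv_areaDensity {G : Euc n → Euc m} {y : Euc n} (hG : ContDiffAt ℝ ∞ G y)
    (hi : Function.Injective (fderiv ℝ G y)) (k : Fin n) :
    fderiv ℝ (areaDensity G) y (EuclideanSpace.single k 1) = areaDensity G y *
      ∑ i, ∑ j, (metric G y)⁻¹ i j * inner ℝ (partialDeriv G j y) (partialDeriv₂ G i k y) := by
  have hp : ∀ i, DifferentiableAt ℝ (partialDeriv G i) y := fun i =>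
    (contDiffAt_partialDeriv hG i).differentiableAt (by simp)
  have hg : ∀ i j, HasFDerivAt (fun z => metric G z i j) (fderiv ℝ (fun z => metric G z i j) y) y :=
    fun i j => ((contDiffAt_metric hG i j).differentiableAt (by simp)).hasFDerivAt
  have hdg : ∀ i j, fderiv ℝ (fun z => metric G z j i) y (EuclideanSpace.single k 1)
      = inner ℝ (partialDeriv G j y) (partialDeriv₂ G i k y)
        + inner ℝ (partialDeriv G i y) (partialDeriv₂ G j k y) := by
    intro i j
    simp only [metric_apply]
    rw [fderiv_inner_apply ℝ (hp j) (hp i), partialDeriv₂_symm hG i k, partialDeriv₂_symm hG j k,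
      real_inner_comm (partialDeriv₂ G k j y)]
    rfl
  have hpos := det_metric_pos hi
  have h := (hasFDerivAt_det hg hpos.ne').sqrt hpos.ne'
  rw [show areaDensity G = fun z => Real.sqrt (metric G z).det from rfl, h.fderiv]
  simp only [_root_.smul_apply, _root_.sum_apply, smul_eq_mul, hdg, mul_add,
    Finset.sum_add_distrib]
  have hsw : ∑ i, ∑ j, (metric G y)⁻¹ i j * inner ℝ (partialDeriv G i y) (partialDeriv₂ G j k y)
      = ∑ i, ∑ j, (metric G y)⁻¹ i j * inner ℝ (partialDeriv G j y) (partialDeriv₂ G i k y) := by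
    rw [Finset.sum_comm]
    refine Finset.sum_congr rfl fun i _ => Finset.sum_congr rfl fun j _ => ?_
    rw [metric_inv_symm]
  rw [hsw]
  have hs : Real.sqrt (metric G y).det ≠ 0 := (Real.sqrt_pos.2 hpos).ne'
  have hs2 : Real.sqrt (metric G y).det ^ 2 = (metric G y).det := Real.sq_sqrt hpos.le
  field_simp
  rw [hs2]
  ring

/-- The `i`-th component `√(det g) ∑ⱼ gⁱʲ ∂ⱼ G` of the gradient density of `G`. -/
noncomputable def gradDensity (G : Euc n → Euc m) (i : Fin n) (y : Euc n) : Euc m :=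
  ∑ j, (areaDensity G y * (metric G y)⁻¹ i j) • partialDeriv G j y

theorem contDiffAt_gradDensity {G : Euc n → Euc m} {y : Euc n} (hG : ContDiffAt ℝ ∞ G y)
    (hi : Function.Injective (fderiv ℝ G y)) (i : Fin n) :
    ContDiffAt ℝ ∞ (gradDensity G i) y :=
  ContDiffAt.sum fun j _ => ((contDiffAt_areaDensity hG hi).mul
    (contDiffAt_inv_metric hG hi i j)).smul (contDiffAt_partialDeriv hG j)

theorem inner_gradDensity {G : Euc n → Euc m} {y : Euc n}
    (hi : Function.Injective (fderiv ℝ G y)) (i k : Fin n) :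
    inner ℝ (gradDensity G i y) (partialDeriv G k y) = if i = k then areaDensity G y else 0 := by
  simp only [gradDensity, sum_inner, real_inner_smul_left, mul_assoc, ← metric_apply,
    ← Finset.mul_sum]
  rw [sum_inv_metric_mul hi]
  simp

/-- The coordinate form of `Δ G = H`: `∑ ∂ᵢ (√(det g) gⁱʲ ∂ⱼ G) = √(det g) H`. The left-hand side
is normal because `⟨√(det g) gⁱʲ ∂ⱼ G, ∂ₖ G⟩ = √(det g) δᵢₖ`, and its normal part only involves
the second derivatives of `G`. -/
theorem sum_fderiv_gradDensity {G : Euc n → Euc m} {U : Set (Euc n)} (hU : IsOpen U)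
    (hG : ContDiffOn ℝ ∞ G U) (hi : ∀ y ∈ U, Function.Injective (fderiv ℝ G y))
    {y : Euc n} (hy : y ∈ U) :
    ∑ i, fderiv ℝ (gradDensity G i) y (EuclideanSpace.single i 1)
      = areaDensity G y • meanCurvatureVector G y := by
  have hGy := hG.contDiffAt (hU.mem_nhds hy)
  have hp : ∀ i, DifferentiableAt ℝ (partialDeriv G i) y := fun i =>
    (contDiffAt_partialDeriv hGy i).differentiableAt (by simp)
  have hZ : ∀ i, DifferentiableAt ℝ (gradDensity G i) y := fun i =>
    (contDiffAt_gradDensity hGy (hi y hy) i).differentiableAt (by simp)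
  have hc : ∀ i j, DifferentiableAt ℝ (fun z => areaDensity G z * (metric G z)⁻¹ i j) y :=
    fun i j => ((contDiffAt_areaDensity hGy (hi y hy)).mul
      (contDiffAt_inv_metric hGy (hi y hy) i j)).differentiableAt (by simp)
  -- the divergence is a normal vector
  have hnormal : ∑ i, fderiv ℝ (gradDensity G i) y (EuclideanSpace.single i 1)
      ∈ (paramTangent G y)ᗮ := by
    rw [mem_paramTangent_orthogonal]
    intro k
    have h1 : ∀ i, inner ℝ (fderiv ℝ (gradDensity G i) y (EuclideanSpace.single i 1))
        (partialDeriv G k y) = (if i = k then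
          fderiv ℝ (areaDensity G) y (EuclideanSpace.single i 1) else 0)
          - inner ℝ (gradDensity G i y) (partialDeriv₂ G i k y) := by
      intro i
      have heq : (fun z => inner ℝ (gradDensity G i z) (partialDeriv G k z))
          =ᶠ[𝓝 y] fun z => if i = k then areaDensity G z else 0 := by
        filter_upwards [hU.mem_nhds hy] with z hz using inner_gradDensity (hi z hz) i k
      have h2 := congrArg (fun L : Euc n →L[ℝ] ℝ => L (EuclideanSpace.single i 1))
        (heq.fderiv_eq (𝕜 := ℝ))
      simp only [fderiv_inner_apply ℝ (hZ i) (hp k)] at h2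
      have h3 : fderiv ℝ (fun z => if i = k then areaDensity G z else 0) y
          (EuclideanSpace.single i 1) = if i = k then
            fderiv ℝ (areaDensity G) y (EuclideanSpace.single i 1) else 0 := by
        by_cases hik : i = k <;> simp [hik]
      rw [← h3, ← h2]
      simp [partialDeriv₂, partialDeriv]
    rw [sum_inner, Finset.sum_congr rfl fun i _ => h1 i, Finset.sum_sub_distrib,
      Finset.sum_ite_eq' Finset.univ k, if_pos (Finset.mem_univ k),
      fderiv_areaDensity hGy (hi y hy), sub_eq_zero, Finset.mul_sum]
    refine Finset.sum_congr rfl fun i _ => ?_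
    simp only [gradDensity, sum_inner, real_inner_smul_left, Finset.mul_sum, mul_assoc]
  rw [← Submodule.starProjection_eq_self_iff.2 hnormal, map_sum, meanCurvatureVector,
    Finset.smul_sum]
  refine Finset.sum_congr rfl fun i _ => ?_
  have hd : fderiv ℝ (gradDensity G i) y (EuclideanSpace.single i 1)
      = ∑ j, ((areaDensity G y * (metric G y)⁻¹ i j) • partialDeriv₂ G i j y
        + (fderiv ℝ (fun z => areaDensity G z * (metric G z)⁻¹ i j) y
            (EuclideanSpace.single i 1)) • partialDeriv G j y) := by
    rw [show gradDensity G i = fun z => ∑ j, (areaDensity G z * (metric G z)⁻¹ i j) •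
      partialDeriv G j z from rfl, fderiv_fun_sum fun j _ => (hc i j).fun_smul (hp j)]
    simp only [_root_.sum_apply]
    refine Finset.sum_congr rfl fun j _ => ?_
    rw [fderiv_fun_smul (hc i j) (hp j)]
    simp [partialDeriv₂, partialDeriv]
  have h0 : ∀ j, (paramTangent G y)ᗮ.starProjection (partialDeriv G j y) = 0 := fun j => by
    rw [Submodule.starProjection_apply_eq_zero_iff, Submodule.orthogonal_orthogonal]
    exact partialDeriv_mem_paramTangent G y j
  rw [hd, map_sum, Finset.smul_sum]
  refine Finset.sum_congr rfl fun j _ => ?_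
  rw [map_add, map_smul, map_smul, h0, smul_zero, add_zero, mul_smul]
  rfl

/-- Pointwise form of the first variation formula:
`∑ ∂ᵢ (√(det g) gⁱʲ ⟨W, ∂ⱼ G⟩) = √(det g) (∑ gⁱʲ ⟨∂ᵢ W, ∂ⱼ G⟩ + ⟨H, W⟩)`. -/
theorem sum_fderiv_inner_gradDensity {G W : Euc n → Euc m} {U : Set (Euc n)} (hU : IsOpen U)
    (hG : ContDiffOn ℝ ∞ G U) (hi : ∀ y ∈ U, Function.Injective (fderiv ℝ G y))
    {y : Euc n} (hy : y ∈ U) (hW : DifferentiableAt ℝ W y) :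
    ∑ i, fderiv ℝ (fun z => inner ℝ (W z) (gradDensity G i z)) y (EuclideanSpace.single i 1)
      = areaDensity G y * ((∑ i, ∑ j, (metric G y)⁻¹ i j *
        inner ℝ (partialDeriv W i y) (partialDeriv G j y))
          + inner ℝ (W y) (meanCurvatureVector G y)) := by
  have hGy := hG.contDiffAt (hU.mem_nhds hy)
  have hZ : ∀ i, DifferentiableAt ℝ (gradDensity G i) y := fun i =>
    (contDiffAt_gradDensity hGy (hi y hy) i).differentiableAt (by simp)
  simp only [fun i => fderiv_inner_apply ℝ hW (hZ i), Finset.sum_add_distrib, ← inner_sum,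
    sum_fderiv_gradDensity hU hG hi hy]
  rw [mul_add, add_comm, real_inner_smul_right]
  congr 1
  rw [Finset.mul_sum]
  refine Finset.sum_congr rfl fun i _ => ?_
  rw [gradDensity, inner_sum, Finset.mul_sum]
  refine Finset.sum_congr rfl fun j _ => ?_
  rw [real_inner_smul_right, mul_assoc]
  rfl

/-- The integral of a partial derivative of a compactly supported function vanishes. -/
theorem integral_fderiv_apply_eq_zero {f : Euc n → ℝ} (hf : ContDiff ℝ 1 f)
    (hc : HasCompactSupport f) (v : Euc n) : ∫ y, fderiv ℝ f y v = 0 := by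
  have hcont : Continuous fun y => fderiv ℝ f y v :=
    (hf.continuous_fderiv (by simp)).clm_apply continuous_const
  have hi : Integrable (fun y => fderiv ℝ f y v) :=
    hcont.integrable_of_hasCompactSupport (hc.fderiv_apply ℝ v)
  have h := integral_mul_fderiv_eq_neg_fderiv_mul_of_integrable (μ := (volume : Measure (Euc n)))
    (f := fun _ => (1 : ℝ)) (g := f) (v := v) (by simp) (by simpa using hi)
    (by simpa using hf.continuous.integrable_of_hasCompactSupport hc)
    (fun x _ => differentiableAt_const _) (fun x _ => hf.differentiable (by simp) x)
  simpa using h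

/-- The first variation formula for a parametrization. -/
theorem integral_divergence_chart {G W : Euc n → Euc m} {U : Set (Euc n)} (hU : IsOpen U)
    (hG : ContDiffOn ℝ ∞ G U) (hi : ∀ y ∈ U, Function.Injective (fderiv ℝ G y))
    (hW : ContDiffOn ℝ 1 W U) (hc : HasCompactSupport W) (hWU : tsupport W ⊆ U) :
    IntegrableOn (fun y => areaDensity G y * ((∑ i, ∑ j, (metric G y)⁻¹ i j *
        inner ℝ (partialDeriv W i y) (partialDeriv G j y))
          + inner ℝ (W y) (meanCurvatureVector G y))) U ∧
    ∫ y in U, areaDensity G y * ((∑ i, ∑ j, (metric G y)⁻¹ i j *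
        inner ℝ (partialDeriv W i y) (partialDeriv G j y))
          + inner ℝ (W y) (meanCurvatureVector G y)) = 0 := by
  set Y : Fin n → Euc n → ℝ := fun i z => inner ℝ (W z) (gradDensity G i z) with hY
  have hYs : ∀ i, tsupport (Y i) ⊆ tsupport W := fun i =>
    closure_mono fun z hz hWz => hz (by simp [hY, hWz])
  have hYc : ∀ i, HasCompactSupport (Y i) := fun i =>
    hc.mono' ((subset_tsupport _).trans (hYs i))
  have hYd : ∀ i, ContDiff ℝ 1 (Y i) := fun i => contDiff_iff_contDiffAt.2 fun z => by
    by_cases hz : z ∈ tsupport (Y i)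
    swap
    · exact contDiffAt_const.congr_of_eventuallyEq (notMem_tsupport_iff_eventuallyEq.1 hz)
    have hzU := hWU (hYs i hz)
    exact (hW.contDiffAt (hU.mem_nhds hzU)).inner ℝ ((contDiffAt_gradDensity
      (hG.contDiffAt (hU.mem_nhds hzU)) (hi z hzU) i).of_le (by simp))
  have hint : ∀ i, Integrable fun y => fderiv ℝ (Y i) y (EuclideanSpace.single i 1) := fun i =>
    (((hYd i).continuous_fderiv (by simp)).clm_apply
      continuous_const).integrable_of_hasCompactSupport ((hYc i).fderiv_apply ℝ _)
  have hEq : ∀ y ∈ U, ∑ i, fderiv ℝ (Y i) y (EuclideanSpace.single i 1)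
      = areaDensity G y * ((∑ i, ∑ j, (metric G y)⁻¹ i j *
        inner ℝ (partialDeriv W i y) (partialDeriv G j y))
          + inner ℝ (W y) (meanCurvatureVector G y)) := fun y hy =>
    sum_fderiv_inner_gradDensity hU hG hi hy
      ((hW.contDiffAt (hU.mem_nhds hy)).differentiableAt (by simp))
  constructor
  · exact ((integrable_finsetSum _ fun i _ => hint i).integrableOn).congr_fun hEq hU.measurableSet
  · rw [← setIntegral_congr_fun hU.measurableSet hEq,
      setIntegral_eq_integral_of_forall_compl_eq_zero, integral_finsetSum _ fun i _ => hint i]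
    · exact Finset.sum_eq_zero fun i _ => integral_fderiv_apply_eq_zero (hYd i) (hYc i) _
    · intro y hy
      refine Finset.sum_eq_zero fun i _ => ?_
      have : y ∉ tsupport (fderiv ℝ (Y i)) := fun h =>
        hy (hWU (hYs i (tsupport_fderiv_subset ℝ h)))
      simp [image_eq_zero_of_notMem_tsupport this]

/-! ### Parametrizations of an immersion and its area measure -/

section AreaMeasure

variable {M : Type*} [TopologicalSpace M] [ChartedSpace (Euc n) M]
  [IsManifold (𝓡 n) ∞ M]

theorem contDiffOn_comp_symm {k : ℕ} {f : M → Euc k} (hf : ContMDiff (𝓡 n) (𝓡 k) ∞ f)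
    {e : OpenPartialHomeomorph M (Euc n)} (he : e ∈ atlas (Euc n) M) :
    ContDiffOn ℝ ∞ (param f e) e.target :=
  (hf.comp_contMDiffOn (contMDiffOn_symm_of_mem_maximalAtlas
    (IsManifold.subset_maximalAtlas he))).contDiffOn

theorem mdifferentiable_of_mem_atlas_euc {e : OpenPartialHomeomorph M (Euc n)}
    (he : e ∈ atlas (Euc n) M) : e.MDifferentiable (𝓡 n) (𝓡 n) :=
  have : IsManifold (𝓡 n) 1 M := IsManifold.of_le (n := ∞) (by simp)
  mdifferentiable_of_mem_atlas he

theorem fderiv_comp_symm {H : Type*} [NormedAddCommGroup H] [NormedSpace ℝ H] {f : M → H}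
    {e : OpenPartialHomeomorph M (Euc n)} (he : e ∈ atlas (Euc n) M) {y : Euc n}
    (hy : y ∈ e.target) (hf : MDifferentiableAt (𝓡 n) 𝓘(ℝ, H) f (e.symm y)) (v : Euc n) :
    fderiv ℝ (fun z => f (e.symm z)) y v
      = mfderiv (𝓡 n) 𝓘(ℝ, H) f (e.symm y) (mfderiv (𝓡 n) (𝓡 n) e.symm y v) := by
  have h := mfderiv_comp y hf ((mdifferentiable_of_mem_atlas_euc he).mdifferentiableAt_symm hy)
  rw [mfderiv_eq_fderiv] at h
  exact congrArg (fun L : Euc n →L[ℝ] H => L v) h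

theorem mfderiv_symm_bijective {e : OpenPartialHomeomorph M (Euc n)} (he : e ∈ atlas (Euc n) M)
    {y : Euc n} (hy : y ∈ e.target) :
    Function.Bijective (mfderiv (𝓡 n) (𝓡 n) e.symm y) :=
  (mdifferentiable_of_mem_atlas_euc he).symm.mfderiv_bijective hy

theorem injective_fderiv_param {F : M → Euc m} (hF : ContMDiff (𝓡 n) (𝓡 m) ∞ F)
    (hi : ∀ p : M, Function.Injective (mfderiv (𝓡 n) (𝓡 m) F p))
    {e : OpenPartialHomeomorph M (Euc n)} (he : e ∈ atlas (Euc n) M) {y : Euc n}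
    (hy : y ∈ e.target) : Function.Injective (fderiv ℝ (param F e) y) := by
  intro v w h
  change fderiv ℝ (fun z => F (e.symm z)) y v = fderiv ℝ (fun z => F (e.symm z)) y w at h
  rw [fderiv_comp_symm he hy (hF.mdifferentiableAt (by simp)),
    fderiv_comp_symm he hy (hF.mdifferentiableAt (by simp))] at h
  exact (mfderiv_symm_bijective he hy).1 (hi _ h)

theorem paramTangent_eq_tangentPlane {F : M → Euc m} (hF : ContMDiff (𝓡 n) (𝓡 m) ∞ F)
    {e : OpenPartialHomeomorph M (Euc n)} (he : e ∈ atlas (Euc n) M) {y : Euc n}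
    (hy : y ∈ e.target) :
    paramTangent (param F e) y = tangentPlane (n := n) F (e.symm y) := by
  ext v
  constructor
  · rintro ⟨w, rfl⟩
    exact ⟨mfderiv (𝓡 n) (𝓡 n) e.symm y w,
      (fderiv_comp_symm he hy (hF.mdifferentiableAt (by simp)) w).symm⟩
  · rintro ⟨w, rfl⟩
    obtain ⟨w', rfl⟩ := (mfderiv_symm_bijective he hy).2 w
    exact ⟨w', fderiv_comp_symm he hy (hF.mdifferentiableAt (by simp)) w'⟩

theorem continuousOn_areaDensity {F : M → Euc m} (hF : ContMDiff (𝓡 n) (𝓡 m) ∞ F)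
    (hi : ∀ p : M, Function.Injective (mfderiv (𝓡 n) (𝓡 m) F p))
    {e : OpenPartialHomeomorph M (Euc n)} (he : e ∈ atlas (Euc n) M) :
    ContinuousOn (areaDensity (param F e)) e.target := fun _ hy =>
  (contDiffAt_areaDensity ((contDiffOn_comp_symm hF he).contDiffAt (e.open_target.mem_nhds hy))
    (injective_fderiv_param hF hi he hy)).continuousAt.continuousWithinAt

end AreaMeasure

section AreaMeasure

variable {M : Type*} [TopologicalSpace M]

/-- The area measure in a chart, in the parameter domain. -/
noncomputable def paramArea (F : M → Euc m) (e : OpenPartialHomeomorph M (Euc n)) :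
    Measure (Euc n) :=
  (volume.restrict e.target).withDensity fun y => ENNReal.ofReal (areaDensity (param F e) y)

theorem ae_mem_target (F : M → Euc m) (e : OpenPartialHomeomorph M (Euc n)) :
    ∀ᵐ y ∂paramArea F e, y ∈ e.target :=
  (withDensity_absolutelyContinuous _ _).ae_le (ae_restrict_mem e.open_target.measurableSet)

variable [MeasurableSpace M] [BorelSpace M]

theorem aemeasurable_symm_paramArea (F : M → Euc m) (e : OpenPartialHomeomorph M (Euc n)) :
    AEMeasurable e.symm (paramArea F e) :=
  (e.continuousOn_symm.aemeasurable e.open_target.measurableSet).mono_ac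
    (withDensity_absolutelyContinuous _ _)

variable [ChartedSpace (Euc n) M]

/-- Measurability can be checked in the parameter domain, because almost everywhere a function on
`M` is the composition of its coordinate expression with the chart. -/
theorem aestronglyMeasurable_chartArea {F : M → Euc m} {e : OpenPartialHomeomorph M (Euc n)}
    {f : M → ℝ} (hf : AEStronglyMeasurable (f ∘ e.symm) (paramArea F e)) :
    AEStronglyMeasurable f (chartArea F e) := by
  have hsrc : ∀ᵐ p ∂chartArea F e, p ∈ e.source := chartArea_compl_source F e
  have he : AEMeasurable e (chartArea F e) := by
    rw [← Measure.restrict_eq_self_of_ae_mem hsrc]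
    exact e.continuousOn.aemeasurable e.open_source.measurableSet
  have hmap : Measure.map e (chartArea F e) = paramArea F e := by
    have hcomp : AEMeasurable e (Measure.map e.symm (paramArea F e)) := he
    change Measure.map e (Measure.map e.symm (paramArea F e)) = _
    rw [AEMeasurable.map_map_of_aemeasurable hcomp (aemeasurable_symm_paramArea F e)]
    conv_rhs => rw [← Measure.map_id (μ := paramArea F e)]
    refine Measure.map_congr ?_
    filter_upwards [ae_mem_target F e] with y hy using e.right_inv hy
  rw [← hmap] at hf
  refine (hf.comp_aemeasurable he).congr ?_
  filter_upwards [hsrc] with p hp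
  simp [e.left_inv hp]

variable [IsManifold (𝓡 n) ∞ M] [SecondCountableTopology M]

/-- Integration over `M` of a function supported in a chart. -/
theorem integral_areaMeasure_of_chart {F : M → Euc m} (hF : ContMDiff (𝓡 n) (𝓡 m) ∞ F)
    (hi : ∀ p : M, Function.Injective (mfderiv (𝓡 n) (𝓡 m) F p))
    {e : OpenPartialHomeomorph M (Euc n)} (he : e ∈ atlas (Euc n) M) {f : M → ℝ}
    (hf : ∀ p, p ∉ e.source → f p = 0)
    (hint : IntegrableOn (fun y => areaDensity (param F e) y * f (e.symm y)) e.target) :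
    Integrable f (areaMeasure (n := n) F) ∧ ∫ p, f p ∂(areaMeasure (n := n) F)
      = ∫ y in e.target, areaDensity (param F e) y * f (e.symm y) := by
  have hdens : AEMeasurable (fun y => ENNReal.ofReal (areaDensity (param F e) y))
      (volume.restrict e.target) :=
    ((continuousOn_areaDensity hF hi he).aemeasurable e.open_target.measurableSet).ennreal_ofReal
  have hlt : ∀ᵐ y ∂(volume.restrict e.target), ENNReal.ofReal (areaDensity (param F e) y) < ⊤ :=
    ae_of_all _ fun _ => ENNReal.ofReal_lt_top
  have htr : ∀ y, (ENNReal.ofReal (areaDensity (param F e) y)).toReal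
      = areaDensity (param F e) y := fun y => ENNReal.toReal_ofReal (Real.sqrt_nonneg _)
  have hpar : Integrable (f ∘ e.symm) (paramArea F e) := by
    rw [paramArea, integrable_withDensity_iff_integrable_smul₀' hdens hlt]
    simp only [htr, smul_eq_mul, Function.comp_apply]
    exact hint
  have hmeas := aestronglyMeasurable_chartArea hpar.aestronglyMeasurable
  have hch : Integrable f (chartArea F e) :=
    (integrable_map_measure hmeas (aemeasurable_symm_paramArea F e)).2 hpar
  rw [← areaMeasure_restrict hF he] at hch
  have hsupp : Function.support f ⊆ e.source := fun p hp => by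
    by_contra h
    exact hp (hf p h)
  refine ⟨(integrableOn_iff_integrable_of_support_subset hsupp).1 hch, ?_⟩
  rw [← setIntegral_eq_integral_of_forall_compl_eq_zero hf, areaMeasure_restrict hF he]
  refine (integral_map (aemeasurable_symm_paramArea F e) hmeas).trans ?_
  rw [paramArea, integral_withDensity_eq_integral_toReal_smul₀ hdens hlt]
  simp [htr]

theorem isLocallyFiniteMeasure_areaMeasure {F : M → Euc m} (hF : ContMDiff (𝓡 n) (𝓡 m) ∞ F)
    (hi : ∀ p : M, Function.Injective (mfderiv (𝓡 n) (𝓡 m) F p)) :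
    IsLocallyFiniteMeasure (areaMeasure (n := n) F) := by
  refine ⟨fun p => ?_⟩
  set e := chartAt (Euc n) p
  have he : e ∈ atlas (Euc n) M := chart_mem_atlas _ _
  obtain ⟨ε, hε, hb⟩ := Metric.nhds_basis_closedBall.mem_iff.1
    (e.open_target.mem_nhds (mem_chart_target (Euc n) p))
  have hN : e.source ∩ e ⁻¹' Metric.closedBall (e p) ε ∈ 𝓝 p :=
    inter_mem (e.open_source.mem_nhds (mem_chart_source _ p))
      ((e.continuousAt (mem_chart_source _ p)).preimage_mem_nhds
        (Metric.closedBall_mem_nhds _ hε))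
  obtain ⟨N, hNs, hNo, hpN⟩ := mem_nhds_iff.1 hN
  refine ⟨N, hNo.mem_nhds hpN, ?_⟩
  have h1 : areaMeasure (n := n) F N = chartArea F e N := by
    rw [← areaMeasure_restrict hF he, Measure.restrict_apply hNo.measurableSet,
      inter_eq_left.2 (hNs.trans inter_subset_left)]
  rw [h1, chartArea_apply F e hNo.measurableSet]
  have hsub : e.symm ⁻¹' N ∩ e.target ⊆ Metric.closedBall (e p) ε := by
    rintro y ⟨hyN, hy⟩
    have := (hNs hyN).2
    rwa [mem_preimage, e.right_inv hy] at this
  refine (lintegral_mono_set hsub).trans_lt ?_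
  have hint : IntegrableOn (areaDensity (param F e)) (Metric.closedBall (e p) ε) :=
    ((continuousOn_areaDensity hF hi he).mono hb).integrableOn_compact
      (isCompact_closedBall _ _)
  exact hint.lintegral_lt_top

theorem isOpenPosMeasure_areaMeasure {F : M → Euc m} (hF : ContMDiff (𝓡 n) (𝓡 m) ∞ F)
    (hi : ∀ p : M, Function.Injective (mfderiv (𝓡 n) (𝓡 m) F p)) :
    (areaMeasure (n := n) F).IsOpenPosMeasure := by
  refine ⟨fun U hU hne h0 => ?_⟩
  obtain ⟨p, hp⟩ := hne
  set e := chartAt (Euc n) p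
  have he : e ∈ atlas (Euc n) M := chart_mem_atlas _ _
  have h1 : chartArea F e U = 0 := by
    rw [← areaMeasure_restrict hF he]
    exact le_antisymm ((Measure.restrict_apply_le _ _).trans h0.le) zero_le
  have hSo : IsOpen (e.target ∩ e.symm ⁻¹' U) := e.isOpen_inter_preimage_symm hU
  rw [chartArea_apply F e hU.measurableSet, inter_comm, setLIntegral_eq_zero_iff'
    hSo.measurableSet] at h1
  · have hz : volume (e.target ∩ e.symm ⁻¹' U) = 0 := by
      refine measure_mono_null ?_ (ae_iff.1 h1)
      intro y hy
      have hpos := areaDensity_pos (injective_fderiv_param hF hi he hy.1)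
      exact fun h => (ENNReal.ofReal_pos.2 hpos).ne' (h hy)
    refine hSo.measure_ne_zero volume ⟨e p, mem_chart_target _ p, ?_⟩ hz
    simpa [e.left_inv (mem_chart_source _ p)] using hp
  · exact (((continuousOn_areaDensity hF hi he).mono inter_subset_left).aemeasurable
      hSo.measurableSet).ennreal_ofReal

end AreaMeasure

section Scaling

variable {M : Type*} [TopologicalSpace M]

theorem areaDensity_const_smul (G : Euc n → Euc m) {c : ℝ} (hc : 0 ≤ c) (y : Euc n) :
    areaDensity (c • G) y = c ^ n * areaDensity G y := by
  have hm : metric (c • G) y = (c ^ 2) • metric G y := by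
    ext i j
    rw [Matrix.smul_apply, metric_apply, metric_apply, partialDeriv, partialDeriv,
      fderiv_const_smul_field]
    simp [partialDeriv, real_inner_smul_left, real_inner_smul_right]
    ring
  rw [areaDensity, areaDensity, hm, Matrix.det_smul, Fintype.card_fin, ← pow_mul, mul_comm 2 n,
    pow_mul, Real.sqrt_mul (sq_nonneg _), Real.sqrt_sq (pow_nonneg hc n)]

theorem chartArea_const_smul [MeasurableSpace M] (F : M → Euc m) {c : ℝ} (hc : 0 ≤ c)
    (e : OpenPartialHomeomorph M (Euc n)) :
    chartArea (fun p => c • F p) e = ENNReal.ofReal (c ^ n) • chartArea F e := by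
  have h : (fun y => ENNReal.ofReal (Real.sqrt (metric (param (fun p => c • F p) e) y).det))
      = ENNReal.ofReal (c ^ n) •
        fun y => ENNReal.ofReal (Real.sqrt (metric (param F e) y).det) := by
    ext1 y
    have := areaDensity_const_smul (param F e) hc y
    change ENNReal.ofReal (areaDensity (c • param F e) y) = _
    rw [this, ENNReal.ofReal_mul (pow_nonneg hc n)]
    rfl
  rw [chartArea, h, withDensity_smul' _ _ ENNReal.ofReal_ne_top, Measure.map_smul]
  rfl

/-- The area measure of a dilation. -/
theorem areaMeasure_const_smul [ChartedSpace (Euc n) M] [MeasurableSpace M] (F : M → Euc m)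
    {c : ℝ} (hc : 0 < c) :
    areaMeasure (n := n) (fun p => c • F p)
      = ENNReal.ofReal (c ^ n) • areaMeasure (n := n) F := by
  have key : ∀ (F : M → Euc m) {c : ℝ}, 0 < c → areaMeasure (n := n) (fun p => c • F p)
      ≤ ENNReal.ofReal (c ^ n) • areaMeasure (n := n) F := by
    intro F c hc
    refine iSup_le fun e => ?_
    rw [chartArea_const_smul F hc.le]
    refine Measure.le_iff.2 fun A _ => ?_
    simp only [Measure.smul_apply, smul_eq_mul]
    have hle : chartArea F e.1 ≤ areaMeasure (n := n) F :=
      le_iSup (fun e : atlas (Euc n) M => chartArea F e.1) e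
    gcongr
  refine le_antisymm (key F hc) ?_
  have h := key (fun p => c • F p) (inv_pos.2 hc)
  simp only [inv_smul_smul₀ hc.ne'] at h
  refine Measure.le_iff.2 fun A _ => ?_
  simp only [Measure.smul_apply, smul_eq_mul]
  calc ENNReal.ofReal (c ^ n) * areaMeasure (n := n) F A
      ≤ ENNReal.ofReal (c ^ n) * (ENNReal.ofReal (c⁻¹ ^ n) *
        areaMeasure (n := n) (fun p => c • F p) A) := by
        gcongr
        exact h A
    _ = areaMeasure (n := n) (fun p => c • F p) A := by
        rw [← mul_assoc, ← ENNReal.ofReal_mul (by positivity), ← mul_pow, mul_inv_cancel₀ hc.ne']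
        simp

end Scaling

/-! ### The first variation formula -/

section FirstVariation

variable {M : Type*} [TopologicalSpace M] [ChartedSpace (Euc n) M]

/-- The integrand `div_M V + ⟨H, V⟩` of the first variation formula, for a vector field `V` on
`ℝᵐ` and a field `H` along `F`; the divergence along `M` is the trace of `DV` composed with the
tangential projection. -/
noncomputable def variationDensity (F H : M → Euc m) (V : Euc m → Euc m) (p : M) : ℝ :=
  LinearMap.trace ℝ (Euc m)
    (fderiv ℝ V (F p) ∘L (tangentPlane (n := n) F p).starProjection).toLinearMap
    + inner ℝ (V (F p)) (H p)

theorem mvfderiv_congr {f g : M → ℝ} {p : M} (h : f =ᶠ[𝓝 p] g) :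
    mvfderiv (𝓡 n) f p = mvfderiv (𝓡 n) g p := by
  ext v
  exact congrArg (fun L : Euc n →L[ℝ] ℝ => L v) (h.mfderiv_eq (I := 𝓡 n) (I' := 𝓘(ℝ, ℝ)))

theorem mvfderiv_eq_zero_of_notMem_tsupport {ρ : M → ℝ} {p : M} (hp : p ∉ tsupport ρ) :
    mvfderiv (𝓡 n) ρ p = 0 := by
  have h : ρ =ᶠ[𝓝 p] fun _ => (0 : ℝ) := notMem_tsupport_iff_eventuallyEq.1 hp
  rw [mvfderiv_congr h, mvfderiv_const]

theorem mvfderiv_finsetSum {ι : Type*} (J : Finset ι) {f : ι → M → ℝ} {p : M}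
    (hf : ∀ q ∈ J, MDifferentiableAt (𝓡 n) 𝓘(ℝ, ℝ) (f q) p) :
    MDifferentiableAt (𝓡 n) 𝓘(ℝ, ℝ) (fun z => ∑ q ∈ J, f q z) p ∧
    mvfderiv (𝓡 n) (fun z => ∑ q ∈ J, f q z) p = ∑ q ∈ J, mvfderiv (𝓡 n) (f q) p := by
  classical
  induction J using Finset.induction_on with
  | empty => exact ⟨by simpa using mdifferentiableAt_const, by simp [mvfderiv_const]⟩
  | insert q J hq ih =>
    obtain ⟨h1, h2⟩ := ih fun i hi => hf i (Finset.mem_insert_of_mem hi)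
    have h0 := hf q (Finset.mem_insert_self q J)
    simp only [Finset.sum_insert hq]
    exact ⟨h0.add h1, (mvfderiv_fun_add h0 h1).trans (by rw [h2])⟩

variable [IsManifold (𝓡 n) ∞ M]

/-- The divergence term of the field `ρ V` in a chart: besides `ρ div_M V` there is the derivative
of `ρ` along the tangential part of `V`. -/
theorem divergence_smul_chart {F : M → Euc m} (hF : ContMDiff (𝓡 n) (𝓡 m) ∞ F)
    (hi : ∀ p : M, Function.Injective (mfderiv (𝓡 n) (𝓡 m) F p))
    {e : OpenPartialHomeomorph M (Euc n)} (he : e ∈ atlas (Euc n) M)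
    {ρ : M → ℝ} (hρ : ContMDiff (𝓡 n) 𝓘(ℝ, ℝ) ∞ ρ) {V : Euc m → Euc m} (hV : ContDiff ℝ 1 V)
    {τ : ∀ p : M, TangentSpace (𝓡 n) p}
    (hτ : ∀ p, mfderiv (𝓡 n) (𝓡 m) F p (τ p)
      = (tangentPlane (n := n) F p).starProjection (V (F p)))
    {W : Euc n → Euc m} {y : Euc n} (hy : y ∈ e.target)
    (hW : W =ᶠ[𝓝 y] fun z => ρ (e.symm z) • V (F (e.symm z))) :
    ∑ i, ∑ j, (metric (param F e) y)⁻¹ i j *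
        inner ℝ (partialDeriv W i y) (partialDeriv (param F e) j y)
      = ρ (e.symm y) * LinearMap.trace ℝ (Euc m) (fderiv ℝ V (F (e.symm y)) ∘L
          (tangentPlane (n := n) F (e.symm y)).starProjection).toLinearMap
        + mvfderiv (𝓡 n) ρ (e.symm y) (τ (e.symm y)) := by
  set G := param F e with hGdef
  have hinj : Function.Injective (fderiv ℝ G y) := injective_fderiv_param hF hi he hy
  have hGd : DifferentiableAt ℝ G y :=
    ((contDiffOn_comp_symm hF he).contDiffAt (e.open_target.mem_nhds hy)).differentiableAt (by simp)
  have hρm : MDifferentiableAt (𝓡 n) 𝓘(ℝ, ℝ) ρ (e.symm y) := hρ.mdifferentiableAt (by simp)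
  have hρd : DifferentiableAt ℝ (fun z => ρ (e.symm z)) y := by
    have := hρm.comp y ((mdifferentiable_of_mem_atlas_euc he).mdifferentiableAt_symm hy)
    exact this.differentiableAt
  have hVd : DifferentiableAt ℝ V (G y) := hV.differentiable (by simp) _
  have hpW : ∀ i, partialDeriv W i y = ρ (e.symm y) • fderiv ℝ V (G y) (partialDeriv G i y)
      + fderiv ℝ (fun z => ρ (e.symm z)) y (EuclideanSpace.single i 1) • V (G y) := by
    intro i
    have hVG : fderiv ℝ (fun z => V (F (e.symm z))) y = fderiv ℝ V (G y) ∘L fderiv ℝ G y :=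
      fderiv_comp y hVd hGd
    have hVGd : DifferentiableAt ℝ (fun z => V (F (e.symm z))) y := hVd.comp y hGd
    rw [partialDeriv, hW.fderiv_eq, fderiv_fun_smul hρd hVGd, hVG]
    rfl
  set ξ : Euc n := ∑ i, ∑ j, ((metric G y)⁻¹ i j * inner ℝ (V (G y)) (partialDeriv G j y)) •
    EuclideanSpace.single i (1 : ℝ) with hξ
  have hGξ : fderiv ℝ G y ξ = (paramTangent G y).starProjection (V (G y)) := by
    rw [starProjection_paramTangent hinj, hξ]
    simp [map_sum, partialDeriv]
  have hξτ : mfderiv (𝓡 n) (𝓡 n) e.symm y ξ = τ (e.symm y) := by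
    apply hi (e.symm y)
    rw [hτ, ← fderiv_comp_symm he hy (hF.mdifferentiableAt (by simp)),
      ← paramTangent_eq_tangentPlane hF he hy]
    exact hGξ
  have hρξ : mvfderiv (𝓡 n) ρ (e.symm y) (mfderiv (𝓡 n) (𝓡 n) e.symm y ξ)
      = fderiv ℝ (fun z => ρ (e.symm z)) y ξ := (fderiv_comp_symm he hy hρm ξ).symm
  rw [← hξτ, hρξ, hξ, ← paramTangent_eq_tangentPlane hF he hy,
    ← trace_comp_starProjection_paramTangent hinj]
  simp only [hpW, inner_add_left, real_inner_smul_left, mul_add, Finset.sum_add_distrib,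
    map_sum, map_smul, smul_eq_mul, Finset.mul_sum]
  congr 1
  · refine Finset.sum_congr rfl fun i _ => Finset.sum_congr rfl fun j _ => ?_
    rw [mul_left_comm]
    rfl
  · refine Finset.sum_congr rfl fun i _ => Finset.sum_congr rfl fun j _ => ?_
    ring

variable [SecondCountableTopology M] [MeasurableSpace M] [BorelSpace M]

/-- The first variation formula for the field `ρ V` along `F`, where `ρ` is supported in a chart.
The vector `τ p` is the tangential part of `V`, pulled back to `T_pM`. -/
theorem firstVariation_chart {F H : M → Euc m} (hF : ContMDiff (𝓡 n) (𝓡 m) ∞ F)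
    (hi : ∀ p : M, Function.Injective (mfderiv (𝓡 n) (𝓡 m) F p)) (hprop : IsProperMap F)
    {e : OpenPartialHomeomorph M (Euc n)} (he : e ∈ atlas (Euc n) M)
    (hH : ∀ y ∈ e.target, meanCurvatureVector (param F e) y = H (e.symm y))
    {ρ : M → ℝ} (hρ : ContMDiff (𝓡 n) 𝓘(ℝ, ℝ) ∞ ρ) (hρe : tsupport ρ ⊆ e.source)
    {V : Euc m → Euc m} (hV : ContDiff ℝ 1 V) (hVc : HasCompactSupport V)
    {τ : ∀ p : M, TangentSpace (𝓡 n) p}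
    (hτ : ∀ p, mfderiv (𝓡 n) (𝓡 m) F p (τ p)
      = (tangentPlane (n := n) F p).starProjection (V (F p))) :
    Integrable (fun p => ρ p * variationDensity (n := n) F H V p
      + mvfderiv (𝓡 n) ρ p (τ p)) (areaMeasure (n := n) F) ∧
    ∫ p, (ρ p * variationDensity (n := n) F H V p
      + mvfderiv (𝓡 n) ρ p (τ p)) ∂(areaMeasure (n := n) F) = 0 := by
  classical
  set G := param F e with hGdef
  set W₀ : Euc n → Euc m := fun z => ρ (e.symm z) • V (F (e.symm z)) with hW₀
  set W : Euc n → Euc m := e.target.indicator W₀ with hW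
  -- `W` is supported in the image of a compact subset of the domain of the chart
  have hK : IsCompact (tsupport ρ ∩ F ⁻¹' tsupport V) :=
    (hprop.isCompact_preimage hVc).inter_left (isClosed_tsupport ρ)
  have hK' : IsCompact (e '' (tsupport ρ ∩ F ⁻¹' tsupport V)) :=
    hK.image_of_continuousOn (e.continuousOn.mono (inter_subset_left.trans hρe))
  have hWs : Function.support W ⊆ e '' (tsupport ρ ∩ F ⁻¹' tsupport V) := by
    intro y hy
    have hyt : y ∈ e.target := by
      by_contra h
      exact hy (indicator_of_notMem h _)
    have hy' : ρ (e.symm y) • V (F (e.symm y)) ≠ 0 := by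
      rwa [Function.mem_support, hW, indicator_of_mem hyt] at hy
    rw [smul_ne_zero_iff] at hy'
    exact ⟨e.symm y, ⟨subset_tsupport _ hy'.1, subset_tsupport _ hy'.2⟩, e.right_inv hyt⟩
  have hWt : tsupport W ⊆ e.target := by
    refine (closure_minimal hWs hK'.isClosed).trans ?_
    rintro _ ⟨p, hp, rfl⟩
    exact e.map_source (hρe hp.1)
  have hWc : HasCompactSupport W := HasCompactSupport.of_support_subset_isCompact hK' hWs
  have hGc := contDiffOn_comp_symm hF he
  have hρc : ContDiffOn ℝ ∞ (fun z => ρ (e.symm z)) e.target :=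
    (hρ.comp_contMDiffOn (contMDiffOn_symm_of_mem_maximalAtlas
      (IsManifold.subset_maximalAtlas he))).contDiffOn
  have hWd : ContDiffOn ℝ 1 W e.target :=
    ((hρc.of_le (by simp)).smul (hV.comp_contDiffOn (hGc.of_le (by simp)))).congr
      fun y hy => indicator_of_mem hy _
  have hWeq : ∀ y ∈ e.target, W =ᶠ[𝓝 y] W₀ := fun y hy => by
    filter_upwards [e.open_target.mem_nhds hy] with z hz using indicator_of_mem hz _
  obtain ⟨hint, h0⟩ := integral_divergence_chart e.open_target hGc
    (fun y hy => injective_fderiv_param hF hi he hy) hWd hWc hWt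
  have hfun : ∀ y ∈ e.target, areaDensity G y * ((∑ i, ∑ j, (metric G y)⁻¹ i j *
        inner ℝ (partialDeriv W i y) (partialDeriv G j y))
          + inner ℝ (W y) (meanCurvatureVector G y))
      = areaDensity G y * (ρ (e.symm y) * variationDensity (n := n) F H V (e.symm y)
        + mvfderiv (𝓡 n) ρ (e.symm y) (τ (e.symm y))) := by
    intro y hy
    rw [divergence_smul_chart hF hi he hρ hV hτ hy (hWeq y hy), hH y hy, (hWeq y hy).eq_of_nhds,
      hW₀, real_inner_smul_left, variationDensity]
    ring
  obtain ⟨h1, h2⟩ := integral_areaMeasure_of_chart hF hi he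
    (f := fun p => ρ p * variationDensity (n := n) F H V p
      + mvfderiv (𝓡 n) ρ p (τ p)) (fun p hp => by
        have hp' : p ∉ tsupport ρ := fun h => hp (hρe h)
        rw [mvfderiv_eq_zero_of_notMem_tsupport hp', image_eq_zero_of_notMem_tsupport hp']
        simp) (hint.congr_fun hfun e.open_target.measurableSet)
  refine ⟨h1, h2.trans ?_⟩
  rw [← setIntegral_congr_fun e.open_target.measurableSet hfun, h0]

/-- The first variation formula: a proper immersion with mean curvature vector `H` satisfies
`∫ (div_M V + ⟨H, V⟩) = 0` for every compactly supported `C¹` vector field `V`. -/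
theorem firstVariation [T2Space M] {F H : M → Euc m} (hF : ContMDiff (𝓡 n) (𝓡 m) ∞ F)
    (hi : ∀ p : M, Function.Injective (mfderiv (𝓡 n) (𝓡 m) F p)) (hprop : IsProperMap F)
    (hH : ∀ e ∈ atlas (Euc n) M, ∀ y ∈ e.target,
      meanCurvatureVector (param F e) y = H (e.symm y))
    {V : Euc m → Euc m} (hV : ContDiff ℝ 1 V) (hVc : HasCompactSupport V) :
    Integrable (variationDensity (n := n) F H V) (areaMeasure (n := n) F) ∧
    ∫ p, variationDensity (n := n) F H V p ∂(areaMeasure (n := n) F) = 0 := by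
  have : LocallyCompactSpace M := ChartedSpace.locallyCompactSpace (Euc n) M
  have hex : ∀ p : M, ∃ t : TangentSpace (𝓡 n) p, mfderiv (𝓡 n) (𝓡 m) F p t
      = (tangentPlane (n := n) F p).starProjection (V (F p)) := fun p =>
    Submodule.starProjection_apply_mem (tangentPlane (n := n) F p) (V (F p))
  choose τ hτ using hex
  obtain ⟨ρ, hρ⟩ := SmoothPartitionOfUnity.exists_isSubordinate_chartAt_source (𝓡 n) M
  have hK : IsCompact (F ⁻¹' tsupport V) := hprop.isCompact_preimage hVc
  have hfin := ρ.locallyFinite.finite_nonempty_inter_compact hK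
  set J := hfin.toFinset with hJ
  have hterm := fun q : M => firstVariation_chart (H := H) hF hi hprop (chart_mem_atlas (Euc n) q)
    (hH _ (chart_mem_atlas (Euc n) q)) (ρ q).contMDiff (hρ q) hV hVc hτ
  have hsum : ∀ p ∈ F ⁻¹' tsupport V, ∑ q ∈ J, ρ q p = 1 := by
    intro p hp
    rw [← ρ.sum_eq_one (mem_univ p)]
    refine (finsum_eq_sum_of_support_subset _ ?_).symm
    intro q hq
    rw [hJ, Set.Finite.coe_toFinset]
    exact ⟨p, hq, hp⟩
  -- `∑ ρ q = 1` near the points where `V ≠ 0`, so the derivatives of the `ρ q` cancel there;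
  -- where `V = 0`, also `τ = 0`
  have hpt : ∀ p, variationDensity (n := n) F H V p
      = ∑ q ∈ J, (ρ q p * variationDensity (n := n) F H V p
        + mvfderiv (𝓡 n) (ρ q) p (τ p)) := by
    intro p
    have hτ0 : V (F p) = 0 → τ p = 0 := fun h => by
      apply hi p
      rw [hτ, h, map_zero, map_zero]
      rfl
    by_cases hp : F p ∈ tsupport V
    · rw [Finset.sum_add_distrib, ← Finset.sum_mul, hsum p hp, one_mul, left_eq_add]
      by_cases hVp : V (F p) = 0
      · exact Finset.sum_eq_zero fun q _ => by rw [hτ0 hVp, map_zero]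
      · have hloc : (fun z => ∑ q ∈ J, ρ q z) =ᶠ[𝓝 p] fun _ => (1 : ℝ) := by
          filter_upwards [(hV.continuous.comp hF.continuous).continuousAt.eventually_ne hVp]
            with z hz using hsum z (subset_tsupport _ hz)
        have h2 := (mvfderiv_finsetSum J fun q _ =>
          (ρ q).contMDiff.mdifferentiableAt (x := p) (by simp)).2
        rw [mvfderiv_congr hloc, mvfderiv_const] at h2
        rw [← _root_.sum_apply, ← h2]
        rfl
    · have hV0 : V (F p) = 0 := image_eq_zero_of_notMem_tsupport hp
      have hdV : fderiv ℝ V (F p) = 0 :=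
        image_eq_zero_of_notMem_tsupport fun h => hp (tsupport_fderiv_subset ℝ h)
      have hv : variationDensity (n := n) F H V p = 0 := by
        simp [variationDensity, hV0, hdV]
      rw [hv]
      exact (Finset.sum_eq_zero fun q _ => by rw [hτ0 hV0, map_zero, mul_zero, add_zero]).symm
  have hfun : variationDensity (n := n) F H V = fun p => ∑ q ∈ J,
      (ρ q p * variationDensity (n := n) F H V p + mvfderiv (𝓡 n) (ρ q) p (τ p)) :=
    funext hpt
  constructor
  · rw [hfun]
    exact integrable_finsetSum _ fun q _ => (hterm q).1
  · rw [integral_congr_ae (ae_of_all _ hpt), integral_finsetSum _ fun q _ => (hterm q).1]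
    exact Finset.sum_eq_zero fun q _ => (hterm q).2

end FirstVariation

/-! ### The weighted height inequality -/

section Height

variable {M : Type*} [TopologicalSpace M] [ChartedSpace (Euc n) M]

theorem finrank_tangentPlane {F : M → Euc m} {p : M}
    (hi : Function.Injective (mfderiv (𝓡 n) (𝓡 m) F p)) :
    Module.finrank ℝ (tangentPlane (n := n) F p) = n :=
  (LinearMap.finrank_range_of_inj (f := (mfderiv (𝓡 n) (𝓡 m) F p).toLinearMap) hi).trans
    (finrank_euclideanSpace_fin (𝕜 := ℝ))

theorem trace_starProjection (T : Submodule ℝ (Euc m)) :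
    LinearMap.trace ℝ (Euc m) T.starProjection.toLinearMap = Module.finrank ℝ T := by
  have h : LinearMap.IsProj T T.starProjection.toLinearMap :=
    ⟨fun x => Submodule.starProjection_apply_mem T x,
      fun x hx => Submodule.starProjection_eq_self_iff.2 hx⟩
  exact h.trace

/-- The field `u ζ e + ¼ u² ζ x` with `u = ⟨x, e⟩` and `ζ = g(|x|²)²`. -/
noncomputable def heightField (e : Euc m) (g : ℝ → ℝ) (x : Euc m) : Euc m :=
  (inner ℝ x e * g (‖x‖ ^ 2) ^ 2) • e + (1 / 4 * inner ℝ x e ^ 2 * g (‖x‖ ^ 2) ^ 2) • x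

theorem contDiff_heightField (e : Euc m) {g : ℝ → ℝ} (hg : ∀ s, 0 ≤ s → ContDiffAt ℝ 1 g s) :
    ContDiff ℝ 1 (heightField e g) := by
  have h1 : ContDiff ℝ 1 fun x : Euc m => inner ℝ x e := contDiff_id.inner ℝ contDiff_const
  have h2 : ContDiff ℝ 1 fun x : Euc m => g (‖x‖ ^ 2) := contDiff_iff_contDiffAt.2 fun x =>
    (hg _ (sq_nonneg _)).comp x (contDiff_norm_sq ℝ).contDiffAt
  exact ((h1.mul (h2.pow 2)).smul contDiff_const).add
    (((contDiff_const.mul (h1.pow 2)).mul (h2.pow 2)).smul contDiff_id)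

theorem hasCompactSupport_heightField (e : Euc m) {g : ℝ → ℝ} {S : ℝ}
    (hg : ∀ s, S ≤ s → g s = 0) : HasCompactSupport (heightField e g) := by
  refine HasCompactSupport.intro (isCompact_closedBall 0 (|S| + 1)) fun x hx => ?_
  have h : |S| + 1 < ‖x‖ := by simpa using hx
  have hS : S ≤ ‖x‖ ^ 2 := by nlinarith [le_abs_self S, abs_nonneg S]
  simp [heightField, hg _ hS]

theorem fderiv_heightField (e : Euc m) {g g' : ℝ → ℝ} {x : Euc m}
    (hg : HasDerivAt g (g' (‖x‖ ^ 2)) (‖x‖ ^ 2)) :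
    fderiv ℝ (heightField e g) x
      = (g (‖x‖ ^ 2) ^ 2 • innerSL ℝ e + (4 * inner ℝ x e * g (‖x‖ ^ 2) * g' (‖x‖ ^ 2)) •
          innerSL ℝ x).smulRight e
        + ((1 / 2 * inner ℝ x e * g (‖x‖ ^ 2) ^ 2) • innerSL ℝ e
          + (inner ℝ x e ^ 2 * g (‖x‖ ^ 2) * g' (‖x‖ ^ 2)) • innerSL ℝ x).smulRight x
        + (1 / 4 * inner ℝ x e ^ 2 * g (‖x‖ ^ 2) ^ 2) • ContinuousLinearMap.id ℝ (Euc m) := by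
  have hu : HasFDerivAt (fun x : Euc m => inner ℝ x e) (innerSL ℝ e) x := by
    have := (innerSL ℝ e).hasFDerivAt (x := x)
    refine this.congr_of_eventuallyEq (Eventually.of_forall fun z => ?_)
    simp [real_inner_comm]
  have hs : HasFDerivAt (fun x : Euc m => g (‖x‖ ^ 2)) (g' (‖x‖ ^ 2) • (2 • innerSL ℝ x)) x :=
    hg.comp_hasFDerivAt x (hasStrictFDerivAt_norm_sq x).hasFDerivAt
  have h1 := (hu.mul (hs.pow 2)).smul_const e
  have h2 := (((hu.pow 2).const_mul (1 / 4)).mul (hs.pow 2)).smul (hasFDerivAt_id x)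
  have h := h1.add h2
  refine (h.congr_of_eventuallyEq (Eventually.of_forall fun z => ?_)).fderiv.trans ?_
  · simp [heightField]
  · ext1 v
    simp
    module

/-- Pointwise lower bound for the first variation integrand of the height field. The mixed term
`u ⟨∇ζ, e^T⟩` is absorbed by `ζ |e^T|²`, and `|x^T| ≤ |x|`. -/
theorem le_variationDensity_heightField {F : M → Euc m} {p : M}
    (hi : Function.Injective (mfderiv (𝓡 n) (𝓡 m) F p)) (e : Euc m) {g g' : ℝ → ℝ}
    (hg : HasDerivAt g (g' (‖F p‖ ^ 2)) (‖F p‖ ^ 2)) (hgg : g (‖F p‖ ^ 2) * g' (‖F p‖ ^ 2) ≤ 0) :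
    inner ℝ (F p) e ^ 2 * ((n + 2) / 4 * g (‖F p‖ ^ 2) ^ 2 - 4 * ‖F p‖ ^ 2 * g' (‖F p‖ ^ 2) ^ 2
        + ‖F p‖ ^ 2 * (g (‖F p‖ ^ 2) * g' (‖F p‖ ^ 2)))
      ≤ variationDensity (n := n) F
        (fun p => (1 / 2 : ℝ) • (tangentPlane (n := n) F p)ᗮ.starProjection (F p))
        (heightField e g) p := by
  rw [variationDensity, fderiv_heightField e hg]
  set T := tangentPlane (n := n) F p with hT
  set x := F p
  set a := g (‖x‖ ^ 2)
  set a' := g' (‖x‖ ^ 2)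
  set u : ℝ := inner ℝ x e with hu
  set E : ℝ := inner ℝ e (T.starProjection e) with hE
  set X : ℝ := inner ℝ x (T.starProjection e) with hX
  set q : ℝ := inner ℝ x (T.starProjection x) with hq
  have hX' : inner ℝ e (T.starProjection x) = X := by
    rw [hX, ← Submodule.inner_starProjection_left_eq_right, real_inner_comm]
  have htr : LinearMap.trace ℝ (Euc m) (((a ^ 2 • innerSL ℝ e + (4 * u * a * a') •
          innerSL ℝ x).smulRight e
        + ((1 / 2 * u * a ^ 2) • innerSL ℝ e + (u ^ 2 * a * a') • innerSL ℝ x).smulRight x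
        + (1 / 4 * u ^ 2 * a ^ 2) • ContinuousLinearMap.id ℝ (Euc m)) ∘L
          T.starProjection).toLinearMap
      = (a ^ 2 * E + 4 * u * a * a' * X) + (1 / 2 * u * a ^ 2 * X + u ^ 2 * a * a' * q)
        + 1 / 4 * u ^ 2 * a ^ 2 * n := by
    have hsplit : (((a ^ 2 • innerSL ℝ e + (4 * u * a * a') • innerSL ℝ x).smulRight e
        + ((1 / 2 * u * a ^ 2) • innerSL ℝ e + (u ^ 2 * a * a') • innerSL ℝ x).smulRight x
        + (1 / 4 * u ^ 2 * a ^ 2) • ContinuousLinearMap.id ℝ (Euc m)) ∘L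
          T.starProjection).toLinearMap
        = ((a ^ 2 • innerₛₗ ℝ e + (4 * u * a * a') • innerₛₗ ℝ x) ∘ₗ
            T.starProjection.toLinearMap).smulRight e
          + (((1 / 2 * u * a ^ 2) • innerₛₗ ℝ e + (u ^ 2 * a * a') • innerₛₗ ℝ x) ∘ₗ
            T.starProjection.toLinearMap).smulRight x
          + (1 / 4 * u ^ 2 * a ^ 2) • T.starProjection.toLinearMap := by
      ext1 v
      simp
    rw [hsplit, map_add, map_add, map_smul, LinearMap.trace_smulRight, LinearMap.trace_smulRight,
      trace_starProjection, finrank_tangentPlane hi]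
    simp [hX', hE, hX, hq]
  have hN : ∀ w : Euc m, inner ℝ w (Tᗮ.starProjection x) = inner ℝ w x
      - inner ℝ w (T.starProjection x) := by
    intro w
    rw [Submodule.starProjection_orthogonal', _root_.sub_apply, inner_sub_right]
    rfl
  have hs : inner ℝ x x = ‖x‖ ^ 2 := real_inner_self_eq_norm_sq x
  have hq0 : q = ‖T.starProjection x‖ ^ 2 := by
    rw [hq, ← real_inner_self_eq_norm_sq, Submodule.inner_starProjection_left_eq_right,
      Submodule.starProjection_eq_self_iff.2 (Submodule.starProjection_apply_mem T x)]
  have hqs : q ≤ ‖x‖ ^ 2 := by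
    rw [hq0]
    gcongr
    exact Submodule.norm_starProjection_apply_le T x
  -- this is `|g e^T + 2 u g' x^T|²`
  have hsq : 0 ≤ a ^ 2 * E + 4 * u * a * a' * X + 4 * u ^ 2 * a' ^ 2 * q := by
    have h0 : 0 ≤ inner ℝ (T.starProjection (a • e + (2 * u * a') • x))
        (T.starProjection (a • e + (2 * u * a') • x)) := real_inner_self_nonneg
    rw [Submodule.inner_starProjection_left_eq_right,
      Submodule.starProjection_eq_self_iff.2 (Submodule.starProjection_apply_mem T _)] at h0
    simp only [map_add, map_smul, inner_add_left, inner_add_right, real_inner_smul_left,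
      real_inner_smul_right, hX', ← hX, ← hE, ← hq] at h0
    linarith
  rw [htr, real_inner_smul_right, hN, heightField, inner_add_left, inner_add_left,
    real_inner_smul_left, real_inner_smul_left, real_inner_smul_left, real_inner_smul_left, hX',
    hs, real_inner_comm x e]
  have h1 : 0 ≤ u ^ 2 * (a * a') * (q - ‖x‖ ^ 2) :=
    mul_nonneg_of_nonpos_of_nonpos (mul_nonpos_of_nonneg_of_nonpos (sq_nonneg _) hgg)
      (by linarith)
  have h2 : 0 ≤ u ^ 2 * a' ^ 2 * (‖x‖ ^ 2 - q) := mul_nonneg (by positivity) (by linarith)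
  have h3 : 0 ≤ u ^ 2 * a ^ 2 * (‖x‖ ^ 2 - q) := mul_nonneg (by positivity) (by linarith)
  change _ ≤ _ + 1 / 2 * (u * a ^ 2 * u + 1 / 4 * u ^ 2 * a ^ 2 * ‖x‖ ^ 2
    - (u * a ^ 2 * X + 1 / 4 * u ^ 2 * a ^ 2 * q))
  linarith

/-- Integrated height inequality on a self-expander: `∫ u² (b g² - 4 s g'² + s g g') ≤ 0` with
`s = |x|²` and `b = (n + 2) / 4`, for every cutoff `g(s)` with `g g' ≤ 0`. -/
theorem integral_nonpos_of_le_height [IsManifold (𝓡 n) ∞ M] [T2Space M]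
    [SecondCountableTopology M] [MeasurableSpace M] [BorelSpace M] {F : M → Euc m}
    (hF : IsSmoothSelfExpander (n := n) F) (e : Euc m) {g g' : ℝ → ℝ} {S : ℝ}
    (hg : ∀ s, 0 ≤ s → ContDiffAt ℝ 1 g s) (hg' : ∀ s, 0 ≤ s → HasDerivAt g (g' s) s)
    (hgg : ∀ s, 0 ≤ s → g s * g' s ≤ 0) (hS : ∀ s, S ≤ s → g s = 0) {f : M → ℝ}
    (hf : Integrable f (areaMeasure (n := n) F))
    (hle : ∀ p, f p ≤ inner ℝ (F p) e ^ 2 * ((n + 2) / 4 * g (‖F p‖ ^ 2) ^ 2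
      - 4 * ‖F p‖ ^ 2 * g' (‖F p‖ ^ 2) ^ 2 + ‖F p‖ ^ 2 * (g (‖F p‖ ^ 2) * g' (‖F p‖ ^ 2)))) :
    ∫ p, f p ∂(areaMeasure (n := n) F) ≤ 0 := by
  obtain ⟨h1, h2⟩ := firstVariation
    (H := fun p => (1 / 2 : ℝ) • (tangentPlane (n := n) F p)ᗮ.starProjection (F p))
    hF.contMDiff hF.immersion hF.isProperMap (fun c hc y hy => by
      rw [hF.expander c hc y hy, normalPart]
      simp only [paramTangent_eq_tangentPlane hF.contMDiff hc hy]
      rfl) (contDiff_heightField e hg) (hasCompactSupport_heightField e hS)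
  rw [← h2]
  exact integral_mono hf h1 fun p => (hle p).trans
    (le_variationDensity_heightField (hF.immersion p) e (hg' _ (sq_nonneg _)) (hgg _ (sq_nonneg _)))

end Height

/-! ### The choice of the weight -/

section Weight

/-- A smooth decreasing cutoff, equal to `1` on `(-∞, 1]` and to `0` on `[2, ∞)`. -/
noncomputable def cutoff (t : ℝ) : ℝ := Real.smoothTransition (2 - t)

theorem contDiff_cutoff : ContDiff ℝ ∞ cutoff :=
  Real.smoothTransition.contDiff.comp (contDiff_const.sub contDiff_id)

theorem cutoff_nonneg (t : ℝ) : 0 ≤ cutoff t := Real.smoothTransition.nonneg _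

theorem cutoff_eq_one {t : ℝ} (ht : t ≤ 1) : cutoff t = 1 :=
  Real.smoothTransition.one_of_one_le (by linarith)

theorem cutoff_eq_zero {t : ℝ} (ht : 2 ≤ t) : cutoff t = 0 :=
  Real.smoothTransition.zero_of_nonpos (by linarith)

theorem deriv_cutoff_nonpos (t : ℝ) : deriv cutoff t ≤ 0 :=
  Antitone.deriv_nonpos fun _ _ h => Real.smoothTransition.monotone (by linarith)

theorem continuous_deriv_cutoff : Continuous (deriv cutoff) :=
  contDiff_cutoff.continuous_deriv (by simp)

theorem deriv_cutoff_eq_zero_left {t : ℝ} (ht : t < 1) : deriv cutoff t = 0 := by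
  have : cutoff =ᶠ[𝓝 t] fun _ => (1 : ℝ) := by
    filter_upwards [Iio_mem_nhds ht] with s hs using cutoff_eq_one hs.le
  rw [this.deriv_eq, deriv_const]

theorem deriv_cutoff_eq_zero_right {t : ℝ} (ht : 2 < t) : deriv cutoff t = 0 := by
  have : cutoff =ᶠ[𝓝 t] fun _ => (0 : ℝ) := by
    filter_upwards [Ioi_mem_nhds ht] with s hs using cutoff_eq_zero hs.le
  rw [this.deriv_eq, deriv_const]

/-- The error produced by the cutoff. -/
noncomputable def cutoffError (t : ℝ) : ℝ :=
  8 * t * deriv cutoff t ^ 2 - t * cutoff t * deriv cutoff t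

theorem continuous_cutoffError : Continuous cutoffError := by
  have h1 := continuous_deriv_cutoff
  have h2 := contDiff_cutoff.continuous
  unfold cutoffError
  fun_prop

theorem cutoffError_nonneg {t : ℝ} (ht : 0 ≤ t) : 0 ≤ cutoffError t := by
  have h := mul_nonneg (mul_nonneg ht (cutoff_nonneg t)) (neg_nonneg.2 (deriv_cutoff_nonpos t))
  have : 0 ≤ 8 * t * deriv cutoff t ^ 2 := by positivity
  unfold cutoffError
  linarith

theorem cutoffError_eq_zero_left {t : ℝ} (ht : t < 1) : cutoffError t = 0 := by
  simp [cutoffError, deriv_cutoff_eq_zero_left ht]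

theorem cutoffError_eq_zero_right {t : ℝ} (ht : 2 < t) : cutoffError t = 0 := by
  simp [cutoffError, deriv_cutoff_eq_zero_right ht]

/-- The weight `(s + 16 b)^{-b}`. The power is the critical one for the height inequality; the
shift by `16 b` makes the inequality strict. -/
noncomputable def decay (b s : ℝ) : ℝ := (s + 16 * b) ^ (-b)

theorem hasDerivAt_decay {b s : ℝ} (hb : 0 < b) (hs : 0 ≤ s) :
    HasDerivAt (decay b) (-b * decay b s / (s + 16 * b)) s := by
  have hpos : 0 < s + 16 * b := by linarith
  have h := ((hasDerivAt_id s).add_const (16 * b)).rpow_const (p := -b) (Or.inl hpos.ne')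
  refine h.congr_deriv ?_
  simp only [id, decay]
  rw [Real.rpow_sub_one hpos.ne']
  ring

theorem contDiffAt_decay {b s : ℝ} (hb : 0 < b) (hs : 0 ≤ s) : ContDiffAt ℝ 1 (decay b) s := by
  have hpos : 0 < s + 16 * b := by linarith
  exact (contDiffAt_id.add contDiffAt_const).rpow_const_of_ne hpos.ne'

theorem decay_pos {b s : ℝ} (hb : 0 < b) (hs : 0 ≤ s) : 0 < decay b s :=
  Real.rpow_pos_of_pos (by linarith) _

theorem decay_sq_le {n : ℕ} {R s : ℝ} (hR : 0 < R) (hs : R ^ 2 ≤ s) :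
    decay ((n + 2) / 4) s ^ 2 ≤ (R ^ (n + 2))⁻¹ := by
  have hb : (0 : ℝ) < (n + 2) / 4 := by positivity
  have h1 : decay ((n + 2) / 4) s ≤ (R ^ 2) ^ (-((n + 2) / 4 : ℝ)) :=
    Real.rpow_le_rpow_of_nonpos (by positivity) (by linarith) (by linarith)
  calc decay ((n + 2) / 4) s ^ 2 ≤ ((R ^ 2) ^ (-((n + 2) / 4 : ℝ))) ^ 2 := by
        have := decay_pos hb ((sq_nonneg R).trans hs)
        gcongr
    _ = (R ^ (n + 2))⁻¹ := by
        rw [← Real.rpow_natCast R 2, ← Real.rpow_mul hR.le, ← Real.rpow_natCast _ 2,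
          ← Real.rpow_mul hR.le, ← Real.rpow_natCast R (n + 2), ← Real.rpow_neg hR.le]
        congr 1
        push_cast
        ring

/-- The weight with a cutoff at radius `R`, as a function of `s = |x|²`. -/
noncomputable def weight (b R s : ℝ) : ℝ := decay b s * cutoff (s / R ^ 2)

/-- The derivative of `weight`, for `s ≥ 0`. -/
noncomputable def weight' (b R s : ℝ) : ℝ :=
  decay b s * (-b * cutoff (s / R ^ 2) / (s + 16 * b) + deriv cutoff (s / R ^ 2) / R ^ 2)

theorem contDiffAt_weight {b R s : ℝ} (hb : 0 < b) (hs : 0 ≤ s) :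
    ContDiffAt ℝ 1 (weight b R) s :=
  (contDiffAt_decay hb hs).mul ((contDiff_cutoff.of_le (by simp)).contDiffAt.comp s
    (contDiffAt_id.div_const _))

theorem hasDerivAt_weight {b R s : ℝ} (hb : 0 < b) (hs : 0 ≤ s) :
    HasDerivAt (weight b R) (weight' b R s) s := by
  have hc : HasDerivAt (fun s => cutoff (s / R ^ 2)) (deriv cutoff (s / R ^ 2) * (1 / R ^ 2)) s :=
    ((contDiff_cutoff.differentiable (by simp) _).hasDerivAt).comp s
      ((hasDerivAt_id s).div_const (R ^ 2))
  refine ((hasDerivAt_decay hb hs).mul hc).congr_deriv ?_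
  simp only [weight']
  ring

theorem weight_mul_weight'_nonpos {b R s : ℝ} (hb : 0 < b) (hs : 0 ≤ s) :
    weight b R s * weight' b R s ≤ 0 := by
  have hpos : 0 < s + 16 * b := by linarith
  have h1 : 0 ≤ b * cutoff (s / R ^ 2) / (s + 16 * b) :=
    div_nonneg (mul_nonneg hb.le (cutoff_nonneg _)) hpos.le
  have h2 : deriv cutoff (s / R ^ 2) / R ^ 2 ≤ 0 :=
    div_nonpos_of_nonpos_of_nonneg (deriv_cutoff_nonpos _) (sq_nonneg R)
  refine mul_nonpos_of_nonneg_of_nonpos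
    (mul_nonneg (decay_pos hb hs).le (cutoff_nonneg _))
    (mul_nonpos_of_nonneg_of_nonpos (decay_pos hb hs).le ?_)
  rw [neg_mul, neg_div]
  linarith

theorem weight_eq_zero {b R s : ℝ} (hR : 0 < R) (hs : 2 * R ^ 2 ≤ s) : weight b R s = 0 := by
  rw [weight, cutoff_eq_zero ((le_div_iff₀ (by positivity)).2 hs), mul_zero]

/-- The strict height inequality for the weight `g`, up to an error supported in
`R² ≤ s ≤ 2 R²`. -/
theorem le_weight_expression {n : ℕ} {b R s : ℝ} (hb : b = (n + 2) / 4) (hR : 1 ≤ R)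
    (hs : 0 ≤ s) :
    8 * b ^ 2 / (s + 16 * b) * weight b R s ^ 2 - (R ^ (n + 2))⁻¹ * cutoffError (s / R ^ 2)
      ≤ (n + 2) / 4 * weight b R s ^ 2 - 4 * s * weight' b R s ^ 2
        + s * (weight b R s * weight' b R s) := by
  have hb0 : 0 < b := by rw [hb]; positivity
  have hpos : 0 < s + 16 * b := by linarith
  have herr : decay b s ^ 2 * cutoffError (s / R ^ 2)
      ≤ (R ^ (n + 2))⁻¹ * cutoffError (s / R ^ 2) := by
    rcases lt_or_ge (s / R ^ 2) 1 with h | h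
    · simp [cutoffError_eq_zero_left h]
    · rw [hb]
      exact mul_le_mul_of_nonneg_right (decay_sq_le (by linarith)
        (by rwa [one_le_div (by positivity)] at h)) (cutoffError_nonneg (by positivity))
  refine (sub_le_sub_left herr _).trans ?_
  rw [← hb]
  set χ := cutoff (s / R ^ 2) with hχ
  set d := deriv cutoff (s / R ^ 2) with hd
  have key : 8 * b ^ 2 / (s + 16 * b) * χ ^ 2 - cutoffError (s / R ^ 2)
      ≤ b * χ ^ 2 - 4 * s * (-b * χ / (s + 16 * b) + d / R ^ 2) ^ 2
        + s * (χ * (-b * χ / (s + 16 * b) + d / R ^ 2)) := by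
    rw [cutoffError, ← hχ, ← hd]
    set z := b * χ / (s + 16 * b) with hz
    have hzmul : z * (s + 16 * b) = b * χ := div_mul_cancel₀ _ hpos.ne'
    have hz8 : 8 * b ^ 2 / (s + 16 * b) * χ ^ 2 = 8 * b * χ * z := by
      rw [hz]
      ring
    have hneg : -b * χ / (s + 16 * b) = -z := by
      rw [hz]
      ring
    set w := d / R ^ 2 with hw
    have hsd : s / R ^ 2 * d = s * w := by
      rw [hw]
      ring
    have hsw : s * w ^ 2 ≤ s / R ^ 2 * d ^ 2 := by
      have h1 : s * w ^ 2 = s / R ^ 2 * d ^ 2 * (R ^ 2)⁻¹ := by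
        rw [hw]
        field_simp
      rw [h1]
      exact mul_le_of_le_one_right (by positivity) (inv_le_one_of_one_le₀ (one_le_pow₀ hR))
    -- `b χ² - s χ z = 16 b χ z` and `8 s z² ≤ 8 b χ z`
    have h2 : b * χ ^ 2 - s * χ * z = 16 * b * χ * z := by
      linear_combination (-χ) * hzmul
    have hχ0 : 0 ≤ χ := cutoff_nonneg _
    have hz0 : 0 ≤ z := by positivity
    have h3 : s * z ^ 2 ≤ b * χ * z := by
      have : z * s ≤ b * χ := by nlinarith
      nlinarith
    rw [hz8, hneg]
    have h4 : 4 * s * (-z + w) ^ 2 ≤ 8 * (s * z ^ 2) + 8 * (s * w ^ 2) := by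
      nlinarith [mul_nonneg hs (sq_nonneg (z + w))]
    have h5 : s / R ^ 2 * χ * d = χ * (s * w) := by rw [← hsd]; ring
    rw [h5]
    nlinarith
  have hh : 0 ≤ decay b s ^ 2 := sq_nonneg _
  have := mul_le_mul_of_nonneg_left key hh
  simp only [weight, weight', ← hχ, ← hd]
  linarith

end Weight

/-! ### Vanishing of the height over the cone -/

theorem hasCompactSupport_comp_isProperMap {X Y : Type*} [TopologicalSpace X] [TopologicalSpace Y]
    [T2Space X] {ψ : Y → ℝ} (hψ : HasCompactSupport ψ) {F : X → Y} (hF : IsProperMap F) :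
    HasCompactSupport fun p => ψ (F p) :=
  HasCompactSupport.of_support_subset_isCompact (hF.isCompact_preimage hψ)
    fun p (hp : ψ (F p) ≠ 0) => subset_tsupport ψ hp

section TangentCone

variable {M : Type*} [TopologicalSpace M] [ChartedSpace (Euc n) M] [MeasurableSpace M]

/-- Convergence to the tangent cone, tested against functions of the position only. -/
theorem HasTangentConeAtInfinity.tendsto_integral {F : M → Euc m} {P : Submodule ℝ (Euc m)} {k : ℕ}
    (h : HasTangentConeAtInfinity (n := n) F P k) {ψ : Euc m → ℝ} (hψ : Continuous ψ)
    (hψc : HasCompactSupport ψ) :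
    Tendsto (fun r : ℝ => (r ^ n)⁻¹ * ∫ p, ψ (r⁻¹ • F p) ∂(areaMeasure (n := n) F)) atTop
      (𝓝 (k * ∫ x : P, ψ x)) := by
  -- a cutoff in the plane variable, equal to `1` on all orthogonal projections
  set θ : (Euc m →L[ℝ] Euc m) → ℝ := fun A => min 1 (max 0 (2 - ‖A‖)) with hθ
  have hθ1 : ∀ T : Submodule ℝ (Euc m), θ T.starProjection = 1 := by
    intro T
    have h1 : (1 : ℝ) ≤ 2 - ‖T.starProjection‖ := by
      linarith [Submodule.starProjection_norm_le T]
    rw [hθ]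
    exact min_eq_left (h1.trans (le_max_right _ _))
  have hθc : Continuous θ :=
    continuous_const.min (continuous_const.max (continuous_const.sub continuous_norm))
  have hc : Continuous fun z : Euc m × (Euc m →L[ℝ] Euc m) => ψ z.1 * θ z.2 :=
    (hψ.comp continuous_fst).mul (hθc.comp continuous_snd)
  have hcs : HasCompactSupport fun z : Euc m × (Euc m →L[ℝ] Euc m) => ψ z.1 * θ z.2 := by
    refine HasCompactSupport.intro (IsCompact.prod hψc (isCompact_closedBall 0 2)) ?_
    rintro ⟨x, A⟩ hz
    simp only [mem_prod, not_and_or] at hz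
    rcases hz with hz | hz
    · simp [image_eq_zero_of_notMem_tsupport hz]
    · have hA : 2 < ‖A‖ := by simpa using hz
      have : θ A = 0 := by
        rw [hθ]
        simp only
        rw [max_eq_left (by linarith)]
        simp
      simp [this]
  have ht := h _ hc hcs
  simp only [varifold, planeVarifold, hθ1, mul_one] at ht
  refine ht.congr' ?_
  filter_upwards [eventually_gt_atTop 0] with r hr
  rw [areaMeasure_const_smul F (inv_pos.2 hr), integral_smul_measure,
    ENNReal.toReal_ofReal (by positivity), smul_eq_mul, inv_pow]

/-- The varifolds of an empty manifold vanish, so they cannot converge to `k ≥ 1` times a plane. -/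
theorem HasTangentConeAtInfinity.nonempty {F : M → Euc m} {P : Submodule ℝ (Euc m)} {k : ℕ}
    (h : HasTangentConeAtInfinity (n := n) F P k) (hk : 1 ≤ k) : Nonempty M := by
  by_contra hM
  rw [not_nonempty_iff] at hM
  set ψ : Euc m → ℝ := fun x => max 0 (1 - ‖x‖) with hψ
  have hψcont : Continuous ψ := continuous_const.max (continuous_const.sub continuous_norm)
  have hzero : ∀ x : Euc m, 1 ≤ ‖x‖ → ψ x = 0 := fun x hx => max_eq_left (by linarith)
  have hψc : HasCompactSupport ψ := HasCompactSupport.intro (isCompact_closedBall 0 1)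
    fun x hx => hzero x (by simpa using (not_le.1 (by simpa using hx)).le)
  have ht := h.tendsto_integral hψcont hψc
  have hpos : 0 < ∫ x : P, ψ x := by
    refine Continuous.integral_pos_of_hasCompactSupport_nonneg_nonzero (x := (0 : P))
      (hψcont.comp continuous_subtype_val) ?_ (fun x => le_max_left _ _) (by simp [hψ])
    exact HasCompactSupport.intro (isCompact_closedBall (0 : P) 1)
      fun x hx => hzero x (by simpa using (not_le.1 (by simpa using hx)).le)
  have h0 : Tendsto (fun r : ℝ => (r ^ n)⁻¹ * ∫ p, ψ (r⁻¹ • F p) ∂(areaMeasure (n := n) F)) atTop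
      (𝓝 0) := by
    refine tendsto_const_nhds.congr fun r => ?_
    simp [Measure.eq_zero_of_isEmpty]
  have := tendsto_nhds_unique ht h0
  have hk' : (0 : ℝ) < k := by exact_mod_cast hk
  exact (mul_pos hk' hpos).ne' this

variable [IsManifold (𝓡 n) ∞ M] [T2Space M] [SecondCountableTopology M] [BorelSpace M]

theorem integrable_comp_of_hasCompactSupport {F : M → Euc m}
    (hF : IsSmoothSelfExpander (n := n) F) {ψ : Euc m → ℝ} (hψ : Continuous ψ)
    (hψc : HasCompactSupport ψ) : Integrable (fun p => ψ (F p)) (areaMeasure (n := n) F) := by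
  have := isLocallyFiniteMeasure_areaMeasure hF.contMDiff hF.immersion
  exact (hψ.comp hF.contMDiff.continuous).integrable_of_hasCompactSupport
    (hasCompactSupport_comp_isProperMap hψc hF.isProperMap)

/-- The height of a self-expander over its tangent cone at infinity vanishes. The left-hand side
of the weighted height inequality does not depend on `R`, while the error of the cutoff at radius
`R` is the varifold of `R⁻¹ F` tested against a multiple of `⟨x, e⟩²`, which vanishes on the
cone. -/
theorem inner_eq_zero_of_mem_orthogonal {F : M → Euc m} (hF : IsSmoothSelfExpander (n := n) F)
    {P : Submodule ℝ (Euc m)} {k : ℕ} (h : HasTangentConeAtInfinity (n := n) F P k)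
    {e : Euc m} (he : e ∈ Pᗮ) (p₀ : M) : inner ℝ (F p₀) e = 0 := by
  set b : ℝ := (n + 2) / 4 with hb
  have hb0 : 0 < b := by rw [hb]; positivity
  set S : ℝ := ‖F p₀‖ ^ 2 + 1 with hS
  have hS0 : 0 < S := by positivity
  -- the test functions
  set κ : Euc m → ℝ := fun x => inner ℝ x e ^ 2 * (max 0 (1 - ‖x‖ ^ 2 / S) *
    (8 * b ^ 2 / (‖x‖ ^ 2 + 16 * b) * decay b (‖x‖ ^ 2) ^ 2)) with hκ
  set ψ : Euc m → ℝ := fun x => inner ℝ x e ^ 2 * cutoffError (‖x‖ ^ 2) with hψ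
  have hden : ∀ x : Euc m, 0 < ‖x‖ ^ 2 + 16 * b := fun x => by positivity
  have hinner : Continuous fun x : Euc m => inner ℝ x e := continuous_id.inner continuous_const
  have hκcont : Continuous κ := by
    have h1 : Continuous fun x : Euc m => decay b (‖x‖ ^ 2) := continuous_iff_continuousAt.2
      fun x => ((hasDerivAt_decay hb0 (sq_nonneg _)).continuousAt).comp
        (f := fun x : Euc m => ‖x‖ ^ 2) (continuous_norm.pow 2).continuousAt
    have h2 : Continuous fun x : Euc m => 8 * b ^ 2 / (‖x‖ ^ 2 + 16 * b) :=
      continuous_const.div (by fun_prop) fun x => (hden x).ne'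
    have h3 : Continuous fun x : Euc m => max 0 (1 - ‖x‖ ^ 2 / S) := by fun_prop
    exact (hinner.pow 2).mul (h3.mul (h2.mul (h1.pow 2)))
  have hκ0 : ∀ x, 0 ≤ κ x := fun x => by
    have := hden x
    have := le_max_left 0 (1 - ‖x‖ ^ 2 / S)
    positivity
  have hmax : ∀ x : Euc m, S ≤ ‖x‖ ^ 2 → max 0 (1 - ‖x‖ ^ 2 / S) = 0 := fun x hx =>
    max_eq_left (by linarith [(one_le_div hS0).2 hx])
  have hκc : HasCompactSupport κ := by
    refine HasCompactSupport.intro (isCompact_closedBall 0 S) fun x hx => ?_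
    have hx' : S < ‖x‖ := by simpa using hx
    have hx2 : S ≤ ‖x‖ ^ 2 := by nlinarith [sq_nonneg ‖F p₀‖]
    simp [hκ, hmax x hx2]
  have hψcont : Continuous ψ :=
    (hinner.pow 2).mul (continuous_cutoffError.comp (continuous_norm.pow 2))
  have hψc : HasCompactSupport ψ := by
    refine HasCompactSupport.intro (isCompact_closedBall 0 2) fun x hx => ?_
    have hx' : 2 < ‖x‖ := by simpa using hx
    simp [hψ, cutoffError_eq_zero_right (show 2 < ‖x‖ ^ 2 by nlinarith)]
  have hκi := integrable_comp_of_hasCompactSupport hF hκcont hκc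
  -- the height inequality with the cutoff at radius `R`
  have hineq : ∀ R : ℝ, 1 ≤ R → S ≤ R → ∫ p, κ (F p) ∂(areaMeasure (n := n) F)
      ≤ (R ^ n)⁻¹ * ∫ p, ψ (R⁻¹ • F p) ∂(areaMeasure (n := n) F) := by
    intro R hR hSR
    have hR0 : 0 < R := by linarith
    have hscale : ∀ x : Euc m, (R ^ n)⁻¹ * ψ (R⁻¹ • x)
        = inner ℝ x e ^ 2 * ((R ^ (n + 2))⁻¹ * cutoffError (‖x‖ ^ 2 / R ^ 2)) := by
      intro x
      have h1 : ‖R⁻¹ • x‖ ^ 2 = ‖x‖ ^ 2 / R ^ 2 := by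
        rw [norm_smul, norm_inv, Real.norm_of_nonneg hR0.le, mul_pow, inv_pow, inv_mul_eq_div]
      simp only [hψ, h1, real_inner_smul_left]
      rw [pow_add, mul_inv]
      ring
    have hψR : Continuous fun x : Euc m => ψ (R⁻¹ • x) :=
      hψcont.comp (continuous_const_smul R⁻¹)
    have hψRc : HasCompactSupport fun x : Euc m => ψ (R⁻¹ • x) :=
      hψc.comp_smul (inv_ne_zero hR0.ne')
    have hψi := (integrable_comp_of_hasCompactSupport hF hψR hψRc).const_mul (R ^ n)⁻¹
    rw [← sub_nonpos, ← integral_const_mul, ← integral_sub hκi hψi]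
    refine integral_nonpos_of_le_height hF e (g := weight b R) (g' := weight' b R)
      (S := 2 * R ^ 2) (fun s hs => contDiffAt_weight hb0 hs) (fun s hs => hasDerivAt_weight hb0 hs)
      (fun s hs => weight_mul_weight'_nonpos hb0 hs) (fun s hs => weight_eq_zero hR0 hs)
      (hκi.sub hψi) fun p => ?_
    simp only [hscale, hκ, ← mul_sub]
    refine mul_le_mul_of_nonneg_left ?_ (sq_nonneg _)
    refine le_trans (sub_le_sub_right ?_ _)
      (le_weight_expression (n := n) hb hR (sq_nonneg ‖F p‖))
    have hd := hden (F p)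
    rcases le_or_gt S (‖F p‖ ^ 2) with hp | hp
    · rw [hmax _ hp, zero_mul]
      positivity
    · -- here the cutoff equals `1`
      have hcut : weight b R (‖F p‖ ^ 2) = decay b (‖F p‖ ^ 2) := by
        rw [weight, cutoff_eq_one ((div_le_one (by positivity)).2 (by nlinarith)), mul_one]
      rw [hcut]
      refine mul_le_of_le_one_left (by positivity) (max_le zero_le_one ?_)
      have : 0 ≤ ‖F p‖ ^ 2 / S := by positivity
      linarith
  -- the error tends to the integral of `ψ` over the cone, which is zero
  have hlim := h.tendsto_integral hψcont hψc
  have hψP : ∀ x : P, ψ x = 0 := fun x => by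
    simp [hψ, (Submodule.mem_orthogonal P e).1 he x x.2]
  simp only [hψP, integral_zero, mul_zero] at hlim
  have hle : ∫ p, κ (F p) ∂(areaMeasure (n := n) F) ≤ 0 := by
    refine ge_of_tendsto hlim ?_
    filter_upwards [eventually_ge_atTop 1, eventually_ge_atTop S] with R h1 h2 using hineq R h1 h2
  by_contra hne
  have := isOpenPosMeasure_areaMeasure hF.contMDiff hF.immersion
  have := isLocallyFiniteMeasure_areaMeasure hF.contMDiff hF.immersion
  refine hle.not_gt (Continuous.integral_pos_of_hasCompactSupport_nonneg_nonzero (x := p₀)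
    (hκcont.comp hF.contMDiff.continuous) (hasCompactSupport_comp_isProperMap hκc hF.isProperMap)
    (fun p => hκ0 _) ?_)
  have h1 : 0 < 1 - ‖F p₀‖ ^ 2 / S := by
    rw [sub_pos, div_lt_one hS0]
    linarith
  have h2 := hden (F p₀)
  have h3 := decay_pos hb0 (sq_nonneg ‖F p₀‖)
  have h4 : 0 < max 0 (1 - ‖F p₀‖ ^ 2 / S) := lt_max_of_lt_right h1
  exact (mul_pos (by positivity) (by positivity)).ne'

theorem mem_of_hasTangentConeAtInfinity {F : M → Euc m} (hF : IsSmoothSelfExpander (n := n) F)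
    {P : Submodule ℝ (Euc m)} {k : ℕ} (h : HasTangentConeAtInfinity (n := n) F P k) (p : M) :
    F p ∈ P := by
  rw [← Submodule.orthogonal_orthogonal P, Submodule.mem_orthogonal']
  exact fun e he => inner_eq_zero_of_mem_orthogonal hF h he p

end TangentCone

/-! ### Immersions into a plane -/

section IntoPlane

/-- A proper local homeomorphism onto a simply connected space maps every component
bijectively: it is a covering, so it has a global section through every point. -/
theorem bijOn_connectedComponent_of_isProperMap {X Y : Type*} [TopologicalSpace X]
    [TopologicalSpace Y] [T2Space X] [T1Space Y] [SimplyConnectedSpace Y]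
    [LocallyPathConnectedSpace Y] {f : X → Y} (hf : IsProperMap f) (hl : IsLocalHomeomorph f)
    (p : X) : BijOn f (connectedComponent p) univ := by
  have hfin : ∀ y ∈ (univ : Set Y), (f ⁻¹' {y}).Finite := fun y _ =>
    (hf.isCompact_preimage isCompact_singleton).finite
      (.of_openPartialHomeomorph f subset_rfl fun x _ => by
        obtain ⟨φ, hφ, h⟩ := hl x
        exact ⟨φ, hφ, h.symm⟩)
  have hcov : IsCoveringMap f := isCoveringMap_iff_isCoveringMapOn_univ.2
    (hf.isClosedMap.isCoveringMapOn_of_isLocalHomeomorphOn hfin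
      (by simpa [← isLocalHomeomorph_iff_isLocalHomeomorphOn_univ] using hl))
  obtain ⟨s, ⟨hs0, hs⟩, -⟩ := hcov.existsUnique_continuousMap_lifts (ContinuousMap.id Y)
    (a₀ := f p) (e₀ := p) rfl
  have hfs : ∀ y, f (s y) = y := fun y => congrFun hs y
  have hsC : ∀ y, s y ∈ connectedComponent p := fun y =>
    (isPreconnected_range s.continuous).subset_connectedComponent ⟨f p, hs0⟩ ⟨y, rfl⟩
  have hsf : EqOn (s ∘ f) id (connectedComponent p) :=
    hcov.eqOn_of_comp_eqOn isPreconnected_connectedComponent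
      (s.continuous.comp hf.continuous).continuousOn continuousOn_id (fun q _ => hfs (f q))
      mem_connectedComponent hs0
  refine ⟨mapsTo_univ _ _, fun q hq q' hq' h => ?_, fun y _ => ⟨s y, hsC y, hfs y⟩⟩
  have h1 : s (f q) = q := hsf hq
  have h2 : s (f q') = q' := hsf hq'
  rw [← h1, ← h2, h]

variable {M : Type*} [TopologicalSpace M] [ChartedSpace (Euc n) M]
  [IsManifold (𝓡 n) ∞ M]

/-- An immersion of an `n`-manifold into an `n`-plane is a local homeomorphism, by the inverse
function theorem. -/
theorem isLocalHomeomorph_of_forall_mem {F : M → Euc m} (hF : ContMDiff (𝓡 n) (𝓡 m) ∞ F)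
    (hi : ∀ p : M, Function.Injective (mfderiv (𝓡 n) (𝓡 m) F p))
    {P : Submodule ℝ (Euc m)} (hP : Module.finrank ℝ P = n) (hFP : ∀ p, F p ∈ P) :
    IsLocalHomeomorph fun p => (⟨F p, hFP p⟩ : P) := by
  refine IsLocalHomeomorph.mk _ fun p => ?_
  set e := chartAt (Euc n) p
  have he : e ∈ atlas (Euc n) M := chart_mem_atlas _ _
  have hy : e p ∈ e.target := mem_chart_target _ p
  set G : Euc n → P := fun y => P.orthogonalProjectionOnto (param F e y) with hG
  have hGF : ∀ y, (G y : Euc m) = param F e y := fun y =>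
    Submodule.starProjection_eq_self_iff.2 (hFP _)
  have hGc : ContDiffAt ℝ ∞ G (e p) := P.orthogonalProjectionOnto.contDiff.contDiffAt.comp _
    ((contDiffOn_comp_symm hF he).contDiffAt (e.open_target.mem_nhds hy))
  have hGd : HasFDerivAt G (fderiv ℝ G (e p)) (e p) :=
    (hGc.differentiableAt (by simp)).hasFDerivAt
  have hinj : Function.Injective (fderiv ℝ G (e p)) := by
    have h1 : fderiv ℝ (param F e) (e p) = P.subtypeL ∘L fderiv ℝ G (e p) := by
      have h2 := (P.subtypeL.hasFDerivAt.comp (e p) hGd).fderiv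
      rw [← h2]
      congr 1
      exact funext fun y => (hGF y).symm
    intro v w hvw
    apply injective_fderiv_param hF hi he hy
    rw [h1]
    simp [hvw]
  let L : Euc n ≃L[ℝ] P := (LinearEquiv.ofInjectiveOfFinrankEq
    (fderiv ℝ G (e p)).toLinearMap hinj (by rw [hP]; simp)).toContinuousLinearEquiv
  have hL : HasFDerivAt G (L : Euc n →L[ℝ] P) (e p) := hGd
  refine ⟨e.trans (hGc.toOpenPartialHomeomorph G hL (by simp)), ?_, ?_⟩
  · rw [OpenPartialHomeomorph.trans_source]
    exact ⟨mem_chart_source _ p, hGc.mem_toOpenPartialHomeomorph_source hL (by simp)⟩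
  · intro z hz
    rw [OpenPartialHomeomorph.trans_source] at hz
    have h : G (e z) = ⟨F z, hFP z⟩ := Subtype.ext (by rw [hGF, param, e.left_inv hz.1])
    simp [h]

theorem bijOn_connectedComponent_of_forall_mem [T2Space M] {F : M → Euc m}
    (hF : ContMDiff (𝓡 n) (𝓡 m) ∞ F)
    (hi : ∀ p : M, Function.Injective (mfderiv (𝓡 n) (𝓡 m) F p)) (hprop : IsProperMap F)
    {P : Submodule ℝ (Euc m)} (hP : Module.finrank ℝ P = n) (hFP : ∀ p, F p ∈ P) (p : M) :
    BijOn F (connectedComponent p) P := by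
  have hfc : Continuous fun p => (⟨F p, hFP p⟩ : P) := hF.continuous.subtype_mk hFP
  have hfp : IsProperMap fun p => (⟨F p, hFP p⟩ : P) :=
    isProperMap_of_comp_of_inj hfc continuous_subtype_val hprop Subtype.val_injective
  obtain ⟨-, h1, h2⟩ := bijOn_connectedComponent_of_isProperMap hfp
    (isLocalHomeomorph_of_forall_mem hF hi hP hFP) p
  refine ⟨fun q _ => hFP q, fun q hq q' hq' h => h1 hq hq' (Subtype.ext h), fun x hx => ?_⟩
  obtain ⟨q, hq, hqx⟩ := h2 (mem_univ (⟨x, hx⟩ : P))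
  exact ⟨q, hq, congrArg Subtype.val hqx⟩

end IntoPlane

end SelfExpander

theorem mainTheorem12 {n : ℕ} (hn : 1 ≤ n) {M : Type*} [TopologicalSpace M] [T2Space M]
    [SecondCountableTopology M] [MeasurableSpace M] [BorelSpace M]
    [ChartedSpace (EuclideanSpace ℝ (Fin n)) M] [IsManifold (𝓡 n) ∞ M]
    (F : M → EuclideanSpace ℝ (Fin (n + 1)))
    (hF : SelfExpander.IsSmoothSelfExpander (n := n) F)
    (P : Submodule ℝ (EuclideanSpace ℝ (Fin (n + 1)))) (hP : Module.finrank ℝ P = n)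
    (k : ℕ) (hk : 1 ≤ k) (hcone : SelfExpander.HasTangentConeAtInfinity (n := n) F P k) :
    range F = (P : Set (EuclideanSpace ℝ (Fin (n + 1)))) ∧
      ∀ p : M, BijOn F (connectedComponent p) (P : Set (EuclideanSpace ℝ (Fin (n + 1)))) := by
  have hFP := SelfExpander.mem_of_hasTangentConeAtInfinity hF hcone
  have hbij := SelfExpander.bijOn_connectedComponent_of_forall_mem hF.contMDiff hF.immersion
    hF.isProperMap hP hFP
  refine ⟨Subset.antisymm (range_subset_iff.2 hFP) ?_, hbij⟩
  obtain ⟨p⟩ := hcone.nonempty hk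
  exact (hbij p).surjOn.trans (image_subset_range _ _)
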